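/- There exist absolute constants $C>0$ and $c>0$ such that the following holds for all integers $p,K,s,n,N\ge 1$ with $1\le s<K$. Let $A$ be a $p\times K$ matrix whose columns are probability vectors, let $T_*\in\mathbb{R}^K$ be a probability vector whose support $S_*=\mathrm{supp}(T_*)$ has exactly $s$ elements, put $\Pi_*=AT_*$, and let the vector of counts $NX$ have the multinomial distribution $\mathrm{Multinomial}_p(N;\Pi_*)$. (In the topic model, this is one document of length $N$ from a corpus of $n$ documents.) Let $J=\{j: X_j>0\}$. A maximum likelihood estimate $\widehat T_{\rm mle}$ is a maximizer of $\sum_{j\in J}X_j\log(A_{j\cdot}^\top T)$ over all probability vectors $T\in\mathbb{R}^K$ (with $\log 0=-\infty$). Write $T_{\min}=\min_{k\in S_*}T_{*k}$, $\;\overline J=\{j:\Pi_{*j}>0\}$, $\;\varepsilon_j=2\sqrt{\Pi_{*j}\log p/N}+\frac{4\log p}{3N}$, $\;\underline J=\{j:\Pi_{*j}>2\varepsilon_j\}$, $$\xi=\max_{j\in\overline J}\frac{\max_{k\in S_*^c}A_{jk}}{\sum_{k\in S_*}A_{jk}},\qquad \kappa=\kappa(A_{\underline J},s)=\min_{S\subseteq\{1,\dots,K\},\,|S|\le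 s}\ \min_{v\ne 0,\ \|v_S\|_1\ge\|v_{S^c}\|_1}\frac{\sum_{j\in\underline J}|A_{j\cdot}^\top v|}{\|v\|_1}.$$ Assume that $\kappa>0$, that $$N\ \ge\ C\,\frac{\log(s\vee n)}{\kappa^4\,T_{\min}^3},$$ and that $$\left(\kappa^{-1}\sqrt{\frac{\xi s}{T_{\min}}}+1\right)\sqrt{\frac{\xi\log K}{T_{\min}N}}\ \le\ c\,\min_{k\in S_*^c}\ \sum_{j\notin\overline J}A_{jk}.$$ Then, with probability at least $1-\frac2p-\frac4{s\vee n}-\frac4K$, a maximum likelihood estimate exists and every maximum likelihood estimate $\widehat T_{\rm mle}$ satisfies $\mathrm{supp}(\widehat T_{\rm mle})\subseteq\mathrm{supp}(T_*)$. -/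

import Mathlib

open MeasureTheory ProbabilityTheory

namespace TopicModel

noncomputable section

/-- The law of one word: the probability measure on `Fin p` with mass function `q`. -/
def wordLaw {p : ℕ} (q : Fin p → ℝ) : Measure (Fin p) :=
  ∑ j, ENNReal.ofReal (q j) • Measure.dirac j

/-- The vector of word counts of a sequence of `N` words. -/
def wordCount {p N : ℕ} (w : Fin N → Fin p) (j : Fin p) : ℕ :=
  (Finset.univ.filter fun i => w i = j).card

/-- The multinomial distribution `Multinomial_p(N; q)`: the law of the vector of word counts of
`N` independent words with common law `q`. -/
def multinomial {p : ℕ} (N : ℕ) (q : Fin p → ℝ) : Measure (Fin p → ℕ) :=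
  (Measure.pi fun _ : Fin N => wordLaw q).map wordCount

/-- `A` is a word-topic matrix: each of its columns is a probability vector. -/
def IsWordTopic {p K : ℕ} (A : Matrix (Fin p) (Fin K) ℝ) : Prop :=
  ∀ k, (fun j => A j k) ∈ stdSimplex ℝ (Fin p)

/-- The support of a vector. -/
def supp {K : ℕ} (T : Fin K → ℝ) : Finset (Fin K) :=
  Finset.univ.filter fun k => T k ≠ 0

/-- The word frequencies `X = Y / N`. -/
def freq {p : ℕ} (N : ℕ) (y : Fin p → ℕ) (j : Fin p) : ℝ := (y j : ℝ) / N

/-- The set `J` of observed words. -/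
def observed {p : ℕ} (X : Fin p → ℝ) : Finset (Fin p) :=
  Finset.univ.filter fun j => 0 < X j

/-- The log-likelihood `∑_{j ∈ J} X_j log (A_j ⬝ T)`, to be used on `likDomain A X` only. -/
def logLik {p K : ℕ} (A : Matrix (Fin p) (Fin K) ℝ) (X : Fin p → ℝ) (T : Fin K → ℝ) : ℝ :=
  ∑ j ∈ observed X, X j * Real.log (A.mulVec T j)

/-- The points of the simplex at which the log-likelihood is finite (it is `-∞` elsewhere). -/
def likDomain {p K : ℕ} (A : Matrix (Fin p) (Fin K) ℝ) (X : Fin p → ℝ) : Set (Fin K → ℝ) :=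
  {T | T ∈ stdSimplex ℝ (Fin K) ∧ ∀ j ∈ observed X, 0 < A.mulVec T j}

/-- `T` is a maximum likelihood estimate: a maximizer of the log-likelihood over the simplex. -/
def IsMLE {p K : ℕ} (A : Matrix (Fin p) (Fin K) ℝ) (X : Fin p → ℝ) (T : Fin K → ℝ) : Prop :=
  T ∈ likDomain A X ∧ ∀ T' ∈ likDomain A X, logLik A X T' ≤ logLik A X T

/-- The set of the words with positive probability. -/
def overJ {p : ℕ} (q : Fin p → ℝ) : Finset (Fin p) :=
  Finset.univ.filter fun j => 0 < q j

/-- The deviation level `ε_j = 2 √(q_j log p / N) + 4 log p / (3 N)`. -/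
def epsLevel {p : ℕ} (N : ℕ) (q : Fin p → ℝ) (j : Fin p) : ℝ :=
  2 * Real.sqrt (q j * Real.log p / N) + 4 * Real.log p / (3 * N)

/-- The set of the words with probability above `2 ε_j`. -/
def underJ {p : ℕ} (N : ℕ) (q : Fin p → ℝ) : Finset (Fin p) :=
  Finset.univ.filter fun j => 2 * epsLevel N q j < q j

/-- The cone of the nonzero vectors `v` with `‖v_S‖₁ ≥ ‖v_{Sᶜ}‖₁`. -/
def cone {K : ℕ} (S : Finset (Fin K)) : Set (Fin K → ℝ) :=
  {v | v ≠ 0 ∧ ∑ k ∈ Sᶜ, |v k| ≤ ∑ k ∈ S, |v k|}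

/-- The restricted `ℓ₁ → ℓ₁` condition number `κ(A_J, s)` of the submatrix of the rows in `J`. -/
def kappa {p K : ℕ} (A : Matrix (Fin p) (Fin K) ℝ) (J : Finset (Fin p)) (s : ℕ) : ℝ :=
  sInf {r | ∃ S : Finset (Fin K), S.card ≤ s ∧ ∃ v ∈ cone S,
    r = (∑ j ∈ J, |A.mulVec v j|) / ∑ k, |v k|}

/-- The smallest nonzero entry of a probability vector. -/
def tMin {K : ℕ} (T : Fin K → ℝ) : ℝ := ⨅ k : supp T, T k

/-- The quantity `ξ`: the maximum over the words `j` with positive probability of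
`‖A_{j Sᶜ}‖_∞ / ‖A_{j S}‖₁`, where `S` is the support of `T`. -/
def xi {p K : ℕ} (A : Matrix (Fin p) (Fin K) ℝ) (T : Fin K → ℝ) : ℝ :=
  ⨆ j : overJ (A.mulVec T),
    (⨆ k : ((supp T)ᶜ : Finset (Fin K)), |A j k|) / ∑ k ∈ supp T, |A j k|

/-- The minimum over the topics `k` outside the support of `T` of the mass that topic `k` puts
on the words of probability zero. -/
def offMass {p K : ℕ} (A : Matrix (Fin p) (Fin K) ℝ) (T : Fin K → ℝ) : ℝ :=
  ⨅ k : ((supp T)ᶜ : Finset (Fin K)), ∑ j ∈ (overJ (A.mulVec T))ᶜ, A j k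

end

end TopicModel

namespace TopicModel

/-! The proof is a primal-dual witness argument. Write `q = A T`, let `X` be the word frequencies
and `τ` the smallest nonzero entry of `T`. Let `T'` maximise the likelihood over the face of the
simplex carried by the support of `T`, and put `D k = ∑ j, X j * A j k / (A T') j`. By concavity of
the logarithm, if all `D k ≤ 1` then `T'` is a global maximizer, and every maximizer vanishes
wherever `D k < 1` (`isMLE_of_dual_certificate`). On the support, `D k ≤ 1` is the first-order
condition on the face (`sum_div_mulVec_le_one`). It remains to get `D k < 1` off the support.

There, replace `A T'` by `q`. The sum `∑ j, X j * A j k / q j` has mean one minus the mass of topic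
`k` on words of probability zero, so `offMass` is the available slack. It must absorb the
fluctuation of this sum and the cost of the replacement, which is at most `3 * B * ‖T' - T‖₁` with
`B = ξ / τ`, since `A j k ≤ B * q j` wherever `q j > 0` (`support_recovery`).

The `ℓ₁` error comes from a second-order expansion of the likelihood (`l1_dist_le`). With `v = T' -
T` and `χ² = ∑ j, (A v) j ^ 2 / q j`, Cauchy–Schwarz and the condition number give `κ * ‖v‖₁ ≤ χ`.
The empirical quadratic term is at least `χ² / 2`, and the linear noise is of order `χ * √(s log M /
N)`, because the images of the vectors carried by the support span at most `s` dimensions and an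
orthonormal basis suffices (`exists_orthonormal_directions`). Bernstein's inequality with union
bounds controls the quadratic, linear and off-support fluctuations. -/

/-! ### Bernstein inequalities for word frequencies. -/

theorem wordLaw_isProbabilityMeasure {p : ℕ} {q : Fin p → ℝ} (hq : q ∈ stdSimplex ℝ (Fin p)) :
    IsProbabilityMeasure (wordLaw q) := by
  constructor
  simp only [wordLaw, Measure.coe_finsetSum, Finset.sum_apply, Measure.smul_apply, smul_eq_mul,
    measure_univ, mul_one]
  rw [← ENNReal.ofReal_sum_of_nonneg fun j _ => hq.1 j, hq.2, ENNReal.ofReal_one]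

theorem integral_wordLaw {p : ℕ} {q : Fin p → ℝ} (hq : ∀ j, 0 ≤ q j) (f : Fin p → ℝ) :
    ∫ j, f j ∂(wordLaw q) = ∑ j, q j * f j := by
  rw [wordLaw, integral_finsetSum_measure]
  · refine Finset.sum_congr rfl fun j _ => ?_
    rw [integral_smul_measure, integral_dirac, ENNReal.toReal_ofReal (hq j), smul_eq_mul]
  · intro j _
    exact (integrable_dirac (by simp)).smul_measure ENNReal.ofReal_ne_top

/-- Only an upper bound on `x` is required, which is why the one-sided Bernstein bound needs `f ≤ b`
and not `|f| ≤ b`. -/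
theorem exp_le_one_add_add_sq {x : ℝ} (hx : x ≤ 1) : Real.exp x ≤ 1 + x + x ^ 2 := by
  rcases le_total (-1) x with h | h
  · have := Real.abs_exp_sub_one_sub_id_le (abs_le.2 ⟨h, hx⟩)
    linarith [(abs_le.1 this).2]
  · have h1 : Real.exp x ≤ 1 := Real.exp_le_one_iff.2 (by linarith)
    nlinarith

/-- Chernoff bound for the average of a function over independent words. -/
theorem words_chernoff {p N : ℕ} {q : Fin p → ℝ} (hq : q ∈ stdSimplex ℝ (Fin p)) (hN : 0 < N)
    {f : Fin p → ℝ} {v l t : ℝ} (hl : 0 ≤ l) (hfl : ∀ j, l * f j ≤ 1)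
    (hv : ∑ j, q j * f j ^ 2 ≤ v) :
    (Measure.pi fun _ : Fin N => wordLaw q).real
      {w | ∑ j, q j * f j + t ≤ (∑ i, f (w i)) / N} ≤ Real.exp (N * (l ^ 2 * v - l * t)) := by
  have := wordLaw_isProbabilityMeasure hq
  have hN' : (0 : ℝ) < N := by exact_mod_cast hN
  set e := ∑ j, q j * f j with he
  have hset : {w : Fin N → Fin p | e + t ≤ (∑ i, f (w i)) / N}
      = {w | N * (e + t) ≤ ∑ i, f (w i)} := by
    ext w
    simp only [Set.mem_ofPred_eq]
    rw [le_div_iff₀ hN', mul_comm]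
  rw [hset]
  have h1 := measure_ge_le_exp_mul_mgf (μ := Measure.pi fun _ : Fin N => wordLaw q)
    (X := fun w => ∑ i, f (w i)) (N * (e + t)) hl Integrable.of_finite
  refine h1.trans ?_
  have h2 : mgf (fun w : Fin N → Fin p => ∑ i, f (w i)) (Measure.pi fun _ : Fin N => wordLaw q) l
      = (∑ j, q j * Real.exp (l * f j)) ^ N := by
    simp only [mgf, Finset.mul_sum, Real.exp_sum]
    rw [integral_fintype_prod_eq_prod (fun _ : Fin N => fun j => Real.exp (l * f j))]
    simp [integral_wordLaw hq.1]
  rw [h2]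
  have h3 : ∑ j, q j * Real.exp (l * f j) ≤ Real.exp (l * e + l ^ 2 * v) := by
    calc ∑ j, q j * Real.exp (l * f j)
        ≤ ∑ j, q j * (1 + l * f j + (l * f j) ^ 2) :=
          Finset.sum_le_sum fun j _ =>
            mul_le_mul_of_nonneg_left (exp_le_one_add_add_sq (hfl j)) (hq.1 j)
      _ = 1 + l * e + l ^ 2 * ∑ j, q j * f j ^ 2 := by
          simp only [mul_add, Finset.sum_add_distrib, mul_one, hq.2, he, Finset.mul_sum]
          congr 1
          · congr 1
            exact Finset.sum_congr rfl fun j _ => by ring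
          · exact Finset.sum_congr rfl fun j _ => by ring
      _ ≤ (l * e + l ^ 2 * v) + 1 := by nlinarith [sq_nonneg l]
      _ ≤ _ := Real.add_one_le_exp _
  have h4 : (0 : ℝ) ≤ ∑ j, q j * Real.exp (l * f j) :=
    Finset.sum_nonneg fun j _ => mul_nonneg (hq.1 j) (Real.exp_nonneg _)
  calc _ ≤ Real.exp (-l * (N * (e + t))) * Real.exp (l * e + l ^ 2 * v) ^ N := by gcongr
    _ = _ := by
      rw [← Real.exp_nat_mul, ← Real.exp_add]
      congr 1
      ring

/-- Bernstein's inequality for the average of a function over independent words. -/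
theorem words_bernstein {p N : ℕ} {q : Fin p → ℝ} (hq : q ∈ stdSimplex ℝ (Fin p)) (hN : 0 < N)
    {f : Fin p → ℝ} {σ b L : ℝ} (hσ : 0 < σ) (hb : 0 < b) (hL : 0 ≤ L) (hfb : ∀ j, f j ≤ b)
    (hv : ∑ j, q j * f j ^ 2 ≤ σ ^ 2) :
    (Measure.pi fun _ : Fin N => wordLaw q).real
      {w | ∑ j, q j * f j + (2 * σ * √(L / N) + 2 * b * (L / N)) ≤ (∑ i, f (w i)) / N}
        ≤ Real.exp (-L) := by
  have hN' : (0 : ℝ) < N := by exact_mod_cast hN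
  set r := √(L / N) with hr
  have hr0 : 0 ≤ r := Real.sqrt_nonneg _
  have hr2 : L / N = r ^ 2 := (Real.sq_sqrt (by positivity)).symm
  have hL2 : L = N * r ^ 2 := by rw [← hr2]; field_simp
  -- The Chernoff parameter is `min (r / σ) (1 / b)`: the first value minimises the Gaussian
  -- exponent, the second is the largest one with `l * f ≤ 1`. Either way the exponent is at most
  -- `-N * r ^ 2 = -L`.
  rcases le_total (r / σ) (1 / b) with h | h
  · refine (words_chernoff hq hN (l := r / σ) (by positivity) (fun j => ?_) hv).trans ?_
    · calc r / σ * f j ≤ r / σ * b := by gcongr; exact hfb j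
        _ ≤ 1 / b * b := by gcongr
        _ = 1 := by field_simp
    · refine Real.exp_le_exp.2 ?_
      rw [hL2]
      have : (r / σ) ^ 2 * σ ^ 2 - r / σ * (2 * σ * r + 2 * b * (N * r ^ 2 / N))
          = - r ^ 2 - 2 * (r / σ) * b * r ^ 2 := by
        field_simp; ring
      rw [this]
      have : 0 ≤ (N : ℝ) * (2 * (r / σ) * b * r ^ 2) := by positivity
      linarith
  · refine (words_chernoff hq hN (l := 1 / b) (by positivity) (fun j => ?_) hv).trans ?_
    · rw [one_div, inv_mul_le_iff₀ hb, mul_one]; exact hfb j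
    · refine Real.exp_le_exp.2 ?_
      rw [hL2]
      have h5 : σ / b ≤ r := by
        rw [div_le_div_iff₀ hb hσ] at h
        rw [div_le_iff₀ hb]; linarith
      have : (1 / b) ^ 2 * σ ^ 2 - 1 / b * (2 * σ * r + 2 * b * (N * r ^ 2 / N))
          = (σ / b) ^ 2 - 2 * (σ / b) * r - 2 * r ^ 2 := by
        field_simp
        ring
      rw [this]
      have h6 : 0 ≤ σ / b := by positivity
      have : (σ / b) ^ 2 - 2 * (σ / b) * r - 2 * r ^ 2 ≤ - r ^ 2 := by nlinarith
      nlinarith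

theorem sum_freq_wordCount_mul {p N : ℕ} (w : Fin N → Fin p) (f : Fin p → ℝ) :
    ∑ j, freq N (wordCount w) j * f j = (∑ i, f (w i)) / N := by
  have h : ∑ i, f (w i) = ∑ j, (wordCount w j : ℝ) * f j := by
    rw [← Finset.sum_fiberwise (s := Finset.univ) (g := w)]
    refine Finset.sum_congr rfl fun j _ => ?_
    rw [Finset.sum_congr rfl (g := fun _ => f j)
      (fun i hi => by rw [(Finset.mem_filter.1 hi).2]), Finset.sum_const, nsmul_eq_mul, wordCount]
  rw [h, Finset.sum_div]
  refine Finset.sum_congr rfl fun j _ => ?_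
  rw [freq]; ring

/-- Bernstein's inequality for a linear functional of the word frequencies. -/
theorem freq_bernstein {p N : ℕ} {q : Fin p → ℝ} (hq : q ∈ stdSimplex ℝ (Fin p)) (hN : 0 < N)
    {f : Fin p → ℝ} {σ b L : ℝ} (hσ : 0 < σ) (hb : 0 < b) (hL : 0 ≤ L) (hfb : ∀ j, f j ≤ b)
    (hv : ∑ j, q j * f j ^ 2 ≤ σ ^ 2) :
    (Measure.pi fun _ : Fin N => wordLaw q).real
      {w | 2 * σ * √(L / N) + 2 * b * (L / N) ≤ ∑ j, (freq N (wordCount w) j - q j) * f j}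
        ≤ Real.exp (-L) := by
  refine le_trans (le_of_eq ?_) (words_bernstein hq hN hσ hb hL hfb hv)
  congr 1
  ext w
  simp only [Set.mem_ofPred_eq, sub_mul, Finset.sum_sub_distrib, sum_freq_wordCount_mul]
  constructor <;> intro h <;> linarith

/-- Two-sided version of Bernstein's inequality for the word frequencies. -/
theorem freq_bernstein_abs {p N : ℕ} {q : Fin p → ℝ} (hq : q ∈ stdSimplex ℝ (Fin p)) (hN : 0 < N)
    {f : Fin p → ℝ} {σ b L : ℝ} (hσ : 0 < σ) (hb : 0 < b) (hL : 0 ≤ L) (hfb : ∀ j, |f j| ≤ b)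
    (hv : ∑ j, q j * f j ^ 2 ≤ σ ^ 2) :
    (Measure.pi fun _ : Fin N => wordLaw q).real
      {w | 2 * σ * √(L / N) + 2 * b * (L / N) ≤ |∑ j, (freq N (wordCount w) j - q j) * f j|}
        ≤ 2 * Real.exp (-L) := by
  have := wordLaw_isProbabilityMeasure hq
  have h1 := freq_bernstein hq hN hσ hb hL (fun j => (abs_le.1 (hfb j)).2) hv
  have h2 := freq_bernstein hq hN hσ hb hL (f := fun j => - f j)
    (fun j => by linarith [(abs_le.1 (hfb j)).1]) (by simpa using hv)
  rw [two_mul (Real.exp _)]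
  refine le_trans (measureReal_mono ?_ (measure_ne_top _ _))
    ((measureReal_union_le _ _).trans (add_le_add h1 h2))
  intro w hw
  simp only [Set.mem_ofPred_eq, le_abs] at hw
  simpa only [Set.mem_union, Set.mem_ofPred_eq, mul_neg, Finset.sum_neg_distrib] using hw

/-- Words of probability zero are almost surely not observed. -/
theorem measureReal_exists_not_mem_overJ {p N : ℕ} {q : Fin p → ℝ}
    (hq : q ∈ stdSimplex ℝ (Fin p)) :
    (Measure.pi fun _ : Fin N => wordLaw q).real
      {w | ∃ j, 0 < freq N (wordCount w) j ∧ q j = 0} = 0 := by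
  have := wordLaw_isProbabilityMeasure hq
  rw [measureReal_def, ENNReal.toReal_eq_zero_iff]
  left
  have hz : wordLaw q {j | q j = 0} = 0 := by
    simp only [wordLaw, Measure.coe_finsetSum, Finset.sum_apply, Measure.smul_apply, smul_eq_mul]
    refine Finset.sum_eq_zero fun j _ => ?_
    by_cases h : q j = 0
    · simp [h]
    · rw [Measure.dirac_apply' _ (by measurability)]
      simp [h]
  have h1 : ∀ᵐ w ∂(Measure.pi fun _ : Fin N => wordLaw q), ∀ i, q (w i) ≠ 0 := by
    refine ae_all_iff.2 fun i => ?_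
    have h2 : ∀ᵐ j ∂(wordLaw q), q j ≠ 0 := by
      rw [ae_iff]; simpa using hz
    exact (Measure.tendsto_eval_ae_ae (μ := fun _ : Fin N => wordLaw q) (i := i)).eventually h2
  refine measure_mono_null ?_ (ae_iff.1 h1)
  rintro w ⟨j, hj, hqj⟩
  simp only [Set.mem_ofPred_eq, not_forall, not_not]
  have : 0 < wordCount w j := by
    by_contra h0
    have : wordCount w j = 0 := by omega
    simp [freq, this] at hj
  obtain ⟨i, hi⟩ := Finset.card_pos.1 this
  exact ⟨i, by rw [(Finset.mem_filter.1 hi).2]; exact hqj⟩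

/-! ### Deterministic analysis of the likelihood. -/

section Deterministic

variable {p K : ℕ} {A : Matrix (Fin p) (Fin K) ℝ} {T : Fin K → ℝ} {X : Fin p → ℝ}

theorem mem_supp {k : Fin K} : k ∈ supp T ↔ T k ≠ 0 := by simp [supp]

theorem mem_overJ {q : Fin p → ℝ} {j : Fin p} : j ∈ overJ q ↔ 0 < q j := by simp [overJ]

theorem mem_observed {j : Fin p} : j ∈ observed X ↔ 0 < X j := by simp [observed]

theorem IsWordTopic.nonneg (hA : IsWordTopic A) (j : Fin p) (k : Fin K) : 0 ≤ A j k := (hA k).1 j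

theorem IsWordTopic.sum_eq_one (hA : IsWordTopic A) (k : Fin K) : ∑ j, A j k = 1 := (hA k).2

theorem mulVec_apply' (v : Fin K → ℝ) (j : Fin p) : A.mulVec v j = ∑ k, A j k * v k := rfl

theorem mulVec_eq_sum_of_support {S : Finset (Fin K)} {v : Fin K → ℝ} (hv : ∀ k ∉ S, v k = 0)
    (j : Fin p) : A.mulVec v j = ∑ k ∈ S, A j k * v k := by
  rw [mulVec_apply']
  refine (Finset.sum_subset (Finset.subset_univ _) fun k _ hk => ?_).symm
  rw [hv k hk, mul_zero]

theorem sum_mulVec (hA : IsWordTopic A) (v : Fin K → ℝ) : ∑ j, A.mulVec v j = ∑ k, v k := by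
  simp only [mulVec_apply']
  rw [Finset.sum_comm]
  refine Finset.sum_congr rfl fun k _ => ?_
  rw [← Finset.sum_mul, hA.sum_eq_one, one_mul]

theorem mulVec_nonneg (hA : IsWordTopic A) {v : Fin K → ℝ} (hv : ∀ k, 0 ≤ v k) (j : Fin p) :
    0 ≤ A.mulVec v j := by
  rw [mulVec_apply']
  exact Finset.sum_nonneg fun k _ => mul_nonneg (hA.nonneg j k) (hv k)

theorem mulVec_mem_stdSimplex (hA : IsWordTopic A) (hT : T ∈ stdSimplex ℝ (Fin K)) :
    A.mulVec T ∈ stdSimplex ℝ (Fin p) :=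
  ⟨mulVec_nonneg hA hT.1, by rw [sum_mulVec hA, hT.2]⟩

theorem mulVec_le_one (hA : IsWordTopic A) (hT : T ∈ stdSimplex ℝ (Fin K)) (j : Fin p) :
    A.mulVec T j ≤ 1 := by
  rw [← (mulVec_mem_stdSimplex hA hT).2]
  exact Finset.single_le_sum (fun j _ => mulVec_nonneg hA hT.1 j) (Finset.mem_univ j)

theorem supp_nonempty (hT : T ∈ stdSimplex ℝ (Fin K)) : (supp T).Nonempty := by
  by_contra h
  rw [Finset.not_nonempty_iff_eq_empty] at h
  have : ∑ k, T k = 0 := Finset.sum_eq_zero fun k _ => by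
    by_contra hk
    have := mem_supp.2 hk
    simp [h] at this
  rw [hT.2] at this
  exact one_ne_zero this

theorem tMin_le {k : Fin K} (hk : k ∈ supp T) : tMin T ≤ T k :=
  ciInf_le (Set.finite_range fun k : supp T => T k).bddBelow ⟨k, hk⟩

theorem tMin_pos (hT : T ∈ stdSimplex ℝ (Fin K)) : 0 < tMin T := by
  have : Nonempty (supp T) := (supp_nonempty hT).to_subtype
  obtain ⟨k, hk⟩ := exists_eq_ciInf_of_finite (f := fun k : supp T => T k)
  rw [tMin, ← hk]
  exact lt_of_le_of_ne (hT.1 k) (Ne.symm (mem_supp.1 k.2))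

theorem card_mul_tMin_le_one (hT : T ∈ stdSimplex ℝ (Fin K)) : (supp T).card * tMin T ≤ 1 := by
  rw [← hT.2, ← nsmul_eq_mul]
  refine (Finset.card_nsmul_le_sum _ _ _ fun k hk => tMin_le hk).trans ?_
  exact Finset.sum_le_sum_of_subset_of_nonneg (Finset.subset_univ _) fun k _ _ => hT.1 k

theorem tMin_le_one (hT : T ∈ stdSimplex ℝ (Fin K)) : tMin T ≤ 1 := by
  have h1 : (1 : ℝ) ≤ (supp T).card := by exact_mod_cast (supp_nonempty hT).card_pos
  nlinarith [card_mul_tMin_le_one hT, tMin_pos hT]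

theorem tMin_mul_sum_le (hA : IsWordTopic A) (j : Fin p) :
    tMin T * ∑ k ∈ supp T, A j k ≤ A.mulVec T j := by
  rw [mulVec_eq_sum_of_support (S := supp T) (fun k hk => by simpa [mem_supp] using hk),
    Finset.mul_sum]
  refine Finset.sum_le_sum fun k hk => ?_
  rw [mul_comm]
  exact mul_le_mul_of_nonneg_left (tMin_le hk) (hA.nonneg j k)

theorem entry_le_div_tMin (hA : IsWordTopic A) (hT : T ∈ stdSimplex ℝ (Fin K)) (j : Fin p)
    {k : Fin K} (hk : k ∈ supp T) : A j k ≤ A.mulVec T j / tMin T := by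
  rw [le_div_iff₀ (tMin_pos hT), mul_comm]
  refine le_trans ?_ (tMin_mul_sum_le hA j)
  exact mul_le_mul_of_nonneg_left
    (Finset.single_le_sum (fun k _ => hA.nonneg j k) hk) (tMin_pos hT).le

theorem xi_nonneg : 0 ≤ xi A T :=
  Real.iSup_nonneg fun _ => div_nonneg (Real.iSup_nonneg fun _ => abs_nonneg _)
    (Finset.sum_nonneg fun _ _ => abs_nonneg _)

/-- With `a` the mass of row `j` on the support, `A j k ≤ ξ * a` by definition of `ξ`, and `τ * a ≤
(A T) j`. This is the source of `B = ξ / τ`. -/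
theorem entry_le_xi_div_tMin (hA : IsWordTopic A) (hT : T ∈ stdSimplex ℝ (Fin K)) {j : Fin p}
    (hj : 0 < A.mulVec T j) {k : Fin K} (hk : k ∉ supp T) :
    A j k ≤ xi A T / tMin T * A.mulVec T j := by
  set a := ∑ k ∈ supp T, A j k with ha
  have ha' : ∑ k ∈ supp T, |A j k| = a :=
    Finset.sum_congr rfl fun k _ => abs_of_nonneg (hA.nonneg j k)
  -- Needed to clear the denominator in `ξ`: for `a = 0` the quotient would be `0` by convention and
  -- say nothing about `A j k`.
  have ha0 : 0 < a := by
    by_contra h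
    have h0 : a = 0 := le_antisymm (not_lt.1 h) (Finset.sum_nonneg fun k _ => hA.nonneg j k)
    rw [mulVec_eq_sum_of_support (S := supp T) (fun k hk => by simpa [mem_supp] using hk)] at hj
    refine hj.ne' (Finset.sum_eq_zero fun k hk => ?_)
    rw [(Finset.sum_eq_zero_iff_of_nonneg fun k _ => hA.nonneg j k).1 h0 k hk, zero_mul]
  have h1 : |A j k| ≤ ⨆ k : ((supp T)ᶜ : Finset (Fin K)), |A j k| :=
    le_ciSup (f := fun k : ((supp T)ᶜ : Finset (Fin K)) => |A j k|)
      (Set.finite_range _).bddAbove ⟨k, by simpa using hk⟩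
  have h2 : (⨆ k : ((supp T)ᶜ : Finset (Fin K)), |A j k|) / ∑ k ∈ supp T, |A j k| ≤ xi A T :=
    le_ciSup (f := fun j : overJ (A.mulVec T) =>
      (⨆ k : ((supp T)ᶜ : Finset (Fin K)), |A j k|) / ∑ k ∈ supp T, |A j k|)
      (Set.finite_range _).bddAbove ⟨j, mem_overJ.2 hj⟩
  rw [ha', div_le_iff₀ ha0] at h2
  calc A j k ≤ xi A T * a := (le_abs_self _).trans (h1.trans h2)
    _ ≤ xi A T * (A.mulVec T j / tMin T) := by
        refine mul_le_mul_of_nonneg_left ?_ xi_nonneg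
        rw [le_div_iff₀ (tMin_pos hT), mul_comm]
        exact tMin_mul_sum_le hA j
    _ = _ := by ring

theorem offMass_le {k : Fin K} (hk : k ∉ supp T) :
    offMass A T ≤ ∑ j ∈ (overJ (A.mulVec T))ᶜ, A j k :=
  ciInf_le (f := fun k : ((supp T)ᶜ : Finset (Fin K)) => ∑ j ∈ (overJ (A.mulVec T))ᶜ, A j k)
    (Set.finite_range _).bddBelow ⟨k, by simpa using hk⟩

/-- A nonzero vector carried by `S` lies in the cone of `S`, as its mass on the complement is zero.
Enlarging the sum from `J` to all words only weakens the bound, and this is the form used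
afterwards. -/
theorem kappa_mul_le {J : Finset (Fin p)} {s : ℕ} {S : Finset (Fin K)} (hS : S.card ≤ s)
    {v : Fin K → ℝ} (hv : ∀ k ∉ S, v k = 0) :
    kappa A J s * ∑ k, |v k| ≤ ∑ j, |A.mulVec v j| := by
  by_cases h0 : v = 0
  · simp [h0]
  have hpos : 0 < ∑ k, |v k| := by
    obtain ⟨k, hk⟩ := Function.ne_iff.1 h0
    exact Finset.sum_pos' (fun k _ => abs_nonneg _) ⟨k, Finset.mem_univ k, abs_pos.2 hk⟩
  have h1 : kappa A J s ≤ (∑ j ∈ J, |A.mulVec v j|) / ∑ k, |v k| := by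
    refine csInf_le ⟨0, ?_⟩ ⟨S, hS, v, ⟨h0, ?_⟩, rfl⟩
    · rintro r ⟨_, _, w, _, rfl⟩
      positivity
    · rw [Finset.sum_eq_zero fun k hk => by rw [hv k (by simpa using hk), abs_zero]]
      positivity
  rw [le_div_iff₀ hpos] at h1
  exact h1.trans (Finset.sum_le_sum_of_subset_of_nonneg (Finset.subset_univ _)
    fun _ _ _ => abs_nonneg _)

theorem kappa_le_one (hA : IsWordTopic A) {J : Finset (Fin p)} {s : ℕ} (hs : 1 ≤ s) (k : Fin K) :
    kappa A J s ≤ 1 := by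
  have h := kappa_mul_le (A := A) (J := J) (S := {k}) (v := Pi.single k 1) (s := s) (by simpa)
    (fun l hl => Pi.single_eq_of_ne (by simpa using hl) _)
  have h1 : ∑ l, |(Pi.single k (1 : ℝ) : Fin K → ℝ) l| = 1 := by
    rw [Finset.sum_eq_single k (fun l _ hl => by simp [hl]) (by simp)]
    simp
  rw [h1, mul_one] at h
  refine h.trans (le_of_eq (Eq.trans ?_ (hA.sum_eq_one k)))
  refine Finset.sum_congr rfl fun j _ => ?_
  rw [Matrix.mulVec_single_one, Matrix.col_apply, abs_of_nonneg (hA.nonneg j k)]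

/-- Each support topic has weight at least `τ`, so `A j k ≤ (A T) j / τ`. Thus an `ℓ₁` bound on `v`
becomes a uniform relative bound on the change of word probabilities. -/
theorem abs_mulVec_le (hA : IsWordTopic A) (hT : T ∈ stdSimplex ℝ (Fin K)) {v : Fin K → ℝ}
    (hv : ∀ k ∉ supp T, v k = 0) (j : Fin p) :
    |A.mulVec v j| ≤ A.mulVec T j * ((∑ k, |v k|) / tMin T) := by
  rw [mulVec_apply']
  calc |∑ k, A j k * v k| ≤ ∑ k, |A j k * v k| := Finset.abs_sum_le_sum_abs _ _
    _ ≤ ∑ k, A.mulVec T j / tMin T * |v k| := by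
        refine Finset.sum_le_sum fun k _ => ?_
        by_cases hk : k ∈ supp T
        · rw [abs_mul, abs_of_nonneg (hA.nonneg j k)]
          exact mul_le_mul_of_nonneg_right (entry_le_div_tMin hA hT j hk) (abs_nonneg _)
        · simp [hv k hk]
    _ = _ := by rw [← Finset.mul_sum]; ring

theorem mulVec_eq_zero (hA : IsWordTopic A) (hT : T ∈ stdSimplex ℝ (Fin K)) {v : Fin K → ℝ}
    (hv : ∀ k ∉ supp T, v k = 0) {j : Fin p} (hj : A.mulVec T j = 0) : A.mulVec v j = 0 := by
  have := abs_mulVec_le hA hT hv j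
  rw [hj, zero_mul] at this
  exact abs_eq_zero.1 (le_antisymm this (abs_nonneg _))

/-- Cauchy–Schwarz against the weights `A T`, whose sum is one. Words with `(A T) j = 0` are
harmless since `A v` vanishes there too. -/
theorem sq_sum_abs_mulVec_le (hA : IsWordTopic A) (hT : T ∈ stdSimplex ℝ (Fin K))
    {v : Fin K → ℝ} (hv : ∀ k ∉ supp T, v k = 0) :
    (∑ j, |A.mulVec v j|) ^ 2 ≤ ∑ j, A.mulVec v j ^ 2 / A.mulVec T j := by
  have hq := mulVec_mem_stdSimplex hA hT
  have := Finset.sum_sq_le_sum_mul_sum_of_sq_le_mul Finset.univ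
    (r := fun j => |A.mulVec v j|) (f := A.mulVec T)
    (g := fun j => A.mulVec v j ^ 2 / A.mulVec T j) (fun j _ => hq.1 j)
    (fun j _ => div_nonneg (sq_nonneg _) (hq.1 j)) (fun j _ => by
      by_cases h : A.mulVec T j = 0
      · simp [h, mulVec_eq_zero hA hT hv h]
      · rw [sq_abs]
        exact le_of_eq (by field_simp))
  rwa [hq.2, one_mul] at this

theorem sum_observed_mul (hX : ∀ j, 0 ≤ X j) (g : Fin p → ℝ) :
    ∑ j ∈ observed X, X j * g j = ∑ j, X j * g j := by
  refine Finset.sum_subset (Finset.subset_univ _) fun j _ hj => ?_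
  rw [le_antisymm (not_lt.1 (mem_observed.not.1 hj)) (hX j), zero_mul]

/-- Second-order Taylor expansion: for `|u| ≤ 1 / 8` the cubic remainder is at most `u ^ 2 / 7`, and
`1 / 2 - 1 / 7 ≥ 1 / 3`. -/
theorem log_one_add_le {u : ℝ} (hu : |u| ≤ 1 / 8) : Real.log (1 + u) ≤ u - u ^ 2 / 3 := by
  have h := Real.abs_log_sub_add_sum_range_le (x := -u) (by rw [abs_neg]; linarith) 2
  simp only [Finset.sum_range_succ, Finset.sum_range_zero, abs_neg, sub_neg_eq_add] at h
  have h2 : |u| ^ (2 + 1) / (1 - |u|) ≤ u ^ 2 / 7 := by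
    rw [div_le_iff₀ (by linarith), ← sq_abs u]
    nlinarith [sq_nonneg |u|, abs_nonneg u]
  have h3 := (abs_le.1 (h.trans h2)).2
  norm_num at h3
  nlinarith [sq_nonneg u]

/-- Concavity on the segment from `1` to `1 + u`. It shrinks an arbitrary step into the range where
the quadratic expansion of the logarithm is valid. -/
theorem mul_log_one_add_le {t u : ℝ} (ht0 : 0 ≤ t) (ht1 : t ≤ 1) (hu : 0 < 1 + u) :
    t * Real.log (1 + u) ≤ Real.log (1 + t * u) := by
  have := strictConcaveOn_log_Ioi.concaveOn.2 (Set.mem_Ioi.2 one_pos) (Set.mem_Ioi.2 hu)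
    (sub_nonneg.2 ht1) ht0 (by ring)
  simp only [smul_eq_mul, Real.log_one, mul_zero, zero_add] at this
  refine this.trans (le_of_eq ?_)
  congr 1; ring

/-- Deviation of a quadratic form from its mean, entrywise control. -/
theorem abs_sum_mul_sq_le {w : Fin p → ℝ} {B : Matrix (Fin p) (Fin K) ℝ} {S : Finset (Fin K)}
    {δ : ℝ} (h : ∀ k ∈ S, ∀ l ∈ S, |∑ j, w j * (B j k * B j l)| ≤ δ) {v : Fin K → ℝ}
    (hv : ∀ k ∉ S, v k = 0) :
    |∑ j, w j * B.mulVec v j ^ 2| ≤ δ * (∑ k, |v k|) ^ 2 := by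
  have h1 : ∑ j, w j * B.mulVec v j ^ 2
      = ∑ k, ∑ l, v k * v l * ∑ j, w j * (B j k * B j l) := by
    calc ∑ j, w j * B.mulVec v j ^ 2
        = ∑ j, ∑ k, ∑ l, v k * v l * (w j * (B j k * B j l)) := by
          refine Finset.sum_congr rfl fun j _ => ?_
          rw [mulVec_apply', sq, Finset.sum_mul_sum, Finset.mul_sum]
          refine Finset.sum_congr rfl fun k _ => ?_
          rw [Finset.mul_sum]
          exact Finset.sum_congr rfl fun l _ => by ring
      _ = _ := by
          rw [Finset.sum_comm]
          refine Finset.sum_congr rfl fun k _ => ?_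
          rw [Finset.sum_comm]
          exact Finset.sum_congr rfl fun l _ => by rw [Finset.mul_sum]
  have h2 : δ * (∑ k, |v k|) ^ 2 = ∑ k, ∑ l, |v k| * |v l| * δ := by
    rw [sq, Finset.sum_mul_sum, Finset.mul_sum]
    refine Finset.sum_congr rfl fun k _ => ?_
    rw [Finset.mul_sum]
    exact Finset.sum_congr rfl fun l _ => by ring
  rw [h1, h2]
  refine (Finset.abs_sum_le_sum_abs _ _).trans (Finset.sum_le_sum fun k _ => ?_)
  refine (Finset.abs_sum_le_sum_abs _ _).trans (Finset.sum_le_sum fun l _ => ?_)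
  by_cases hk : k ∈ S
  · by_cases hl : l ∈ S
    · rw [abs_mul, abs_mul]
      exact mul_le_mul_of_nonneg_left (h k hk l hl) (by positivity)
    · simp [hv l hl]
  · simp [hv k hk]

/-- The design matrix with rows scaled by the reciprocals of the word probabilities. -/
noncomputable def scaled (A : Matrix (Fin p) (Fin K) ℝ) (q : Fin p → ℝ) :
    Matrix (Fin p) (Fin K) ℝ :=
  Matrix.of fun j k => A j k / q j

theorem scaled_apply (q : Fin p → ℝ) (j : Fin p) (k : Fin K) : scaled A q j k = A j k / q j := rfl

theorem scaled_mulVec (q : Fin p → ℝ) (v : Fin K → ℝ) (j : Fin p) :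
    (scaled A q).mulVec v j = A.mulVec v j / q j := by
  simp only [mulVec_apply', scaled_apply, Finset.sum_div]
  exact Finset.sum_congr rfl fun k _ => by ring

/-- The `ℓ₁` error of a vector supported in the true support that is at least as likely as the
truth. -/
theorem l1_dist_le (hA : IsWordTopic A) (hT : T ∈ stdSimplex ℝ (Fin K))
    (hX : ∀ j, 0 ≤ X j) (hXq : ∀ j, 0 < X j → 0 < A.mulVec T j)
    {κ ρ : ℝ} (hκ : 0 < κ) (hρ0 : 0 ≤ ρ) (hρ : ρ < tMin T / 8)
    (hcond : ∀ v : Fin K → ℝ, (∀ k ∉ supp T, v k = 0) → κ * ∑ k, |v k| ≤ ∑ j, |A.mulVec v j|)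
    (hquad : ∀ k ∈ supp T, ∀ l ∈ supp T, |∑ j, (X j - A.mulVec T j) *
      (scaled A (A.mulVec T) j k * scaled A (A.mulVec T) j l)| ≤ κ ^ 2 / 2)
    (hlin : ∀ v : Fin K → ℝ, (∀ k ∉ supp T, v k = 0) →
      ∑ j, (X j - A.mulVec T j) * (A.mulVec v j / A.mulVec T j)
        ≤ ρ * κ / 6 * √(∑ j, A.mulVec v j ^ 2 / A.mulVec T j))
    {T' : Fin K → ℝ} (hT' : T' ∈ likDomain A X) (hsupp : supp T' ⊆ supp T)
    (hlik : logLik A X T ≤ logLik A X T') : ∑ k, |T' k - T k| ≤ ρ := by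
  set q := A.mulVec T with hq
  have hqs := mulVec_mem_stdSimplex hA hT
  have hτ := tMin_pos hT
  set v : Fin K → ℝ := T' - T with hvdef
  have hv : ∀ k ∉ supp T, v k = 0 := fun k hk => by
    have h1 : T' k = 0 := by
      by_contra h; exact hk (hsupp (mem_supp.2 h))
    have h2 : T k = 0 := by simpa [mem_supp] using hk
    simp [hvdef, h1, h2]
  have hAv : ∀ j, A.mulVec v j = A.mulVec T' j - q j := fun j => by
    rw [hvdef, Matrix.mulVec_sub]; rfl
  change ∑ k, |v k| ≤ ρ
  set D := ∑ k, |v k| with hD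
  by_contra hcon
  push Not at hcon
  have hD0 : 0 < D := lt_of_le_of_lt hρ0 hcon
  -- Localisation: move from `T` towards `T'` until the `ℓ₁` distance is at most `τ / 8`, making all
  -- relative changes at most `1 / 8`, while staying farther than `ρ` away.
  obtain ⟨t, ht0, ht1, htD, htρ⟩ : ∃ t : ℝ, 0 < t ∧ t ≤ 1 ∧ t * D ≤ tMin T / 8 ∧ ρ < t * D := by
    rcases le_total D (tMin T / 8) with h | h
    · exact ⟨1, one_pos, le_rfl, by linarith, by linarith⟩
    · refine ⟨tMin T / 8 / D, by positivity, ?_, ?_, ?_⟩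
      · rw [div_le_one hD0]; exact h
      · rw [div_mul_cancel₀ _ hD0.ne']
      · rw [div_mul_cancel₀ _ hD0.ne']; exact hρ
  set u : Fin p → ℝ := fun j => A.mulVec v j / q j with hu
  have hub : ∀ j, 0 < q j → |t * u j| ≤ 1 / 8 := fun j hj => by
    have h1 := abs_mulVec_le hA hT hv j
    have h2 : |u j| ≤ D / tMin T := by
      rw [hu, abs_div, abs_of_pos hj, div_le_iff₀ hj, mul_comm]; exact h1
    rw [abs_mul, abs_of_pos ht0]
    calc t * |u j| ≤ t * (D / tMin T) := by gcongr
      _ = t * D / tMin T := by ring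
      _ ≤ 1 / 8 := by rw [div_le_iff₀ hτ]; linarith
  have hmain : 0 ≤ ∑ j, X j * (t * u j - (t * u j) ^ 2 / 3) := by
    have h1 : 0 ≤ t * (logLik A X T' - logLik A X T) := mul_nonneg ht0.le (sub_nonneg.2 hlik)
    refine h1.trans ?_
    rw [← sum_observed_mul hX, logLik, logLik, ← Finset.sum_sub_distrib, Finset.mul_sum]
    refine Finset.sum_le_sum fun j hj => ?_
    have hXj := mem_observed.1 hj
    have hqj := hXq j hXj
    have hT'j := hT'.2 j hj
    have h2 : Real.log (A.mulVec T' j) - Real.log (q j) = Real.log (1 + u j) := by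
      rw [← Real.log_div hT'j.ne' hqj.ne', hu]
      congr 1
      simp only [hAv]
      field_simp
      ring
    have h3 : 0 < 1 + u j := by
      have : 1 + u j = A.mulVec T' j / q j := by
        simp only [hu, hAv]; field_simp; ring
      rw [this]; positivity
    calc t * (X j * Real.log (A.mulVec T' j) - X j * Real.log (q j))
        = X j * (t * Real.log (1 + u j)) := by rw [← h2]; ring
      _ ≤ X j * (t * u j - (t * u j) ^ 2 / 3) :=
          mul_le_mul_of_nonneg_left
            ((mul_log_one_add_le ht0.le ht1 h3).trans (log_one_add_le (hub j hqj))) hXj.le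
  have hqu : ∀ j, q j * u j = A.mulVec v j := fun j => by
    by_cases h : q j = 0
    · rw [h, zero_mul, mulVec_eq_zero hA hT hv h]
    · simp only [hu]; field_simp
  -- The columns of `A` sum to one and `T'`, `T` have equal total mass, so the linear term is
  -- centred and only the noise `X - q` remains.
  have hqu0 : ∑ j, q j * u j = 0 := by
    simp only [hqu]
    rw [sum_mulVec hA, hvdef]
    simp [hT'.1.2, hT.2]
  set χ := √(∑ j, A.mulVec v j ^ 2 / q j) with hχ
  have hχ2 : χ ^ 2 = ∑ j, A.mulVec v j ^ 2 / q j :=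
    Real.sq_sqrt (Finset.sum_nonneg fun j _ => div_nonneg (sq_nonneg _) (hqs.1 j))
  have hχq : χ ^ 2 = ∑ j, q j * u j ^ 2 := by
    rw [hχ2]
    refine Finset.sum_congr rfl fun j _ => ?_
    rw [sq (u j), ← mul_assoc, hqu j, hu]
    ring
  have hDχ : κ * D ≤ χ := (hcond v hv).trans (Real.le_sqrt_of_sq_le (sq_sum_abs_mulVec_le hA hT hv))
  have hlin' : ∑ j, X j * u j ≤ ρ * κ / 6 * χ := by
    refine le_trans (le_of_eq ?_) (hlin v hv)
    simp only [sub_mul, Finset.sum_sub_distrib]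
    change _ = ∑ j, X j * u j - ∑ j, q j * u j
    rw [hqu0, sub_zero]
  -- The entrywise deviation costs at most `κ ^ 2 / 2 * D ^ 2`, which is at most `χ ^ 2 / 2` because
  -- `κ * D ≤ χ`.
  have hquad' : χ ^ 2 / 2 ≤ ∑ j, X j * u j ^ 2 := by
    have h1 := abs_sum_mul_sq_le hquad hv
    simp only [scaled_mulVec] at h1
    have h2 := (abs_le.1 h1).1
    simp only [sub_mul, Finset.sum_sub_distrib] at h2
    change _ ≤ ∑ j, X j * u j ^ 2 - ∑ j, q j * u j ^ 2 at h2
    rw [← hχq] at h2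
    have h3 : (κ * D) ^ 2 ≤ χ ^ 2 := by gcongr
    nlinarith
  have hexp : ∑ j, X j * (t * u j - (t * u j) ^ 2 / 3)
      = t * ∑ j, X j * u j - t ^ 2 / 3 * ∑ j, X j * u j ^ 2 := by
    rw [Finset.mul_sum, Finset.mul_sum, ← Finset.sum_sub_distrib]
    exact Finset.sum_congr rfl fun j _ => by ring
  rw [hexp] at hmain
  have hχ0 : 0 < χ := lt_of_lt_of_le (by positivity) hDχ
  have h5 : t ^ 2 / 3 * (χ ^ 2 / 2) ≤ t * (ρ * κ / 6 * χ) := by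
    have a1 : t ^ 2 / 3 * (χ ^ 2 / 2) ≤ t ^ 2 / 3 * ∑ j, X j * u j ^ 2 := by gcongr
    have a2 : t * ∑ j, X j * u j ≤ t * (ρ * κ / 6 * χ) := by gcongr
    linarith
  have h6 : (t * χ / 6) * (t * χ) ≤ (t * χ / 6) * (ρ * κ) := by nlinarith
  have h7 : t * χ ≤ ρ * κ := le_of_mul_le_mul_left h6 (by positivity)
  have h8 : κ * (t * D) ≤ κ * ρ := by nlinarith
  linarith [le_of_mul_le_mul_left h8 hκ]

/-- The likelihood attains its maximum on each compact set of probability vectors that contains a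
point with positive likelihood. -/
theorem exists_max_logLik (hA : IsWordTopic A) (hX : ∀ j, 0 ≤ X j) {F : Set (Fin K → ℝ)}
    (hF : IsCompact F) (hFs : F ⊆ stdSimplex ℝ (Fin K)) {T₀ : Fin K → ℝ} (h0 : T₀ ∈ F)
    (h0' : T₀ ∈ likDomain A X) :
    ∃ T' ∈ F, T' ∈ likDomain A X ∧
      ∀ T'' ∈ F, T'' ∈ likDomain A X → logLik A X T'' ≤ logLik A X T' := by
  have hle : ∀ T'' ∈ likDomain A X, ∀ j ∈ observed X,
      logLik A X T'' ≤ X j * Real.log (A.mulVec T'' j) := by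
    intro T'' hT'' j hj
    rw [logLik, ← Finset.add_sum_erase _ _ hj]
    have : ∑ i ∈ (observed X).erase j, X i * Real.log (A.mulVec T'' i) ≤ 0 :=
      Finset.sum_nonpos fun i hi => mul_nonpos_of_nonneg_of_nonpos (hX i)
        (Real.log_nonpos (mulVec_nonneg hA hT''.1.1 i) (mulVec_le_one hA hT''.1 i))
    linarith
  -- All terms of the log-likelihood are nonpositive, so each one alone bounds it from above. Points
  -- at least as likely as `T₀` therefore keep every observed word's probability above a fixed
  -- positive level; on this closed set the log-likelihood is continuous.
  set G : Set (Fin K → ℝ) :=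
    {T'' | ∀ j ∈ observed X, Real.exp (logLik A X T₀ / X j) ≤ A.mulVec T'' j} with hG
  have hcont : ∀ j, Continuous fun T'' : Fin K → ℝ => A.mulVec T'' j := fun j => by
    simp only [mulVec_apply']; fun_prop
  have hGc : IsClosed G := by
    have : G = ⋂ j ∈ observed X,
        {T'' : Fin K → ℝ | Real.exp (logLik A X T₀ / X j) ≤ A.mulVec T'' j} := by
      ext; simp [hG]
    rw [this]
    exact isClosed_biInter fun j _ => isClosed_le continuous_const (hcont j)
  have hGdom : ∀ T'' ∈ F ∩ G, T'' ∈ likDomain A X := fun T'' h =>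
    ⟨hFs h.1, fun j hj => (Real.exp_pos _).trans_le (h.2 j hj)⟩
  have hmemG : ∀ T'' ∈ likDomain A X, logLik A X T₀ ≤ logLik A X T'' → T'' ∈ G := by
    intro T'' hT'' h j hj
    rw [← Real.le_log_iff_exp_le (hT''.2 j hj), div_le_iff₀ (mem_observed.1 hj), mul_comm]
    exact h.trans (hle T'' hT'' j hj)
  have hlc : ContinuousOn (logLik A X) (F ∩ G) := by
    unfold logLik
    refine continuousOn_finsetSum _ fun j hj => ?_
    exact continuousOn_const.mul ((hcont j).continuousOn.log fun T'' h =>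
      ((hGdom T'' h).2 j hj).ne')
  obtain ⟨T', hT', hmax⟩ := (hF.inter_right hGc).exists_isMaxOn
    ⟨T₀, h0, hmemG T₀ h0' le_rfl⟩ hlc
  refine ⟨T', hT'.1, hGdom T' hT', fun T'' h1 h2 => ?_⟩
  rcases le_total (logLik A X T₀) (logLik A X T'') with h | h
  · exact hmax ⟨h1, hmemG T'' h2 h⟩
  · exact h.trans (hmax ⟨h0, hmemG T₀ h0' le_rfl⟩)

/-- First-order condition in the direction of a topic. -/
theorem sum_div_mulVec_le_one (hA : IsWordTopic A) (hX : ∀ j, 0 ≤ X j) (hX1 : ∑ j, X j = 1)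
    {T' : Fin K → ℝ} (hT' : T' ∈ likDomain A X) {k : Fin K}
    (hmax : ∀ t : ℝ, 0 < t → t < 1 →
      (1 - t) • T' + t • (Pi.single k 1 : Fin K → ℝ) ∈ likDomain A X →
      logLik A X ((1 - t) • T' + t • (Pi.single k 1 : Fin K → ℝ)) ≤ logLik A X T') :
    ∑ j, X j * (A j k / A.mulVec T' j) ≤ 1 := by
  set r := A.mulVec T' with hr
  set d : Fin p → ℝ := fun j => A j k - r j with hd
  have hmv : ∀ (t : ℝ) j,
      A.mulVec ((1 - t) • T' + t • (Pi.single k 1 : Fin K → ℝ)) j = r j + t * d j := by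
    intro t j
    rw [Matrix.mulVec_add, Matrix.mulVec_smul, Matrix.mulVec_smul, Matrix.mulVec_single_one]
    simp only [Pi.add_apply, Pi.smul_apply, smul_eq_mul, Matrix.col_apply, hd, ← hr]
    ring
  have hpos : ∀ t : ℝ, 0 < t → t < 1 → ∀ j ∈ observed X, 0 < r j + t * d j := by
    intro t h0 h1 j hj
    have h2 := hT'.2 j hj
    have h3 := hA.nonneg j k
    have h4 : r j + t * d j = (1 - t) * r j + t * A j k := by simp only [hd]; ring
    rw [h4]
    have : 0 < (1 - t) * r j := mul_pos (by linarith) h2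
    positivity
  have hineq : ∀ t : ℝ, 0 < t → t < 1 → ∑ j ∈ observed X, X j * (d j / (r j + t * d j)) ≤ 0 := by
    intro t h0 h1
    have hdom : (1 - t) • T' + t • (Pi.single k 1 : Fin K → ℝ) ∈ likDomain A X := by
      refine ⟨convex_stdSimplex ℝ (Fin K) hT'.1 (single_mem_stdSimplex ℝ k) (by linarith) h0.le
        (by ring), fun j hj => ?_⟩
      rw [hmv]
      exact hpos t h0 h1 j hj
    have h2 := hmax t h0 h1 hdom
    simp only [logLik, hmv, ← hr] at h2
    have h3 : t * ∑ j ∈ observed X, X j * (d j / (r j + t * d j)) ≤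
        ∑ j ∈ observed X, X j * Real.log (r j + t * d j)
          - ∑ j ∈ observed X, X j * Real.log (r j) := by
      rw [← Finset.sum_sub_distrib, Finset.mul_sum]
      refine Finset.sum_le_sum fun j hj => ?_
      have hp := hpos t h0 h1 j hj
      have hrj := hT'.2 j hj
      have h4 := Real.log_le_sub_one_of_pos (div_pos hrj hp)
      -- The tangent inequality at the moved point bounds the finite increment from below; letting
      -- `t` tend to zero then gives the directional derivative.
      rw [Real.log_div hrj.ne' hp.ne'] at h4
      have h5 : r j / (r j + t * d j) - 1 = - (t * (d j / (r j + t * d j))) := by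
        field_simp
        ring
      rw [h5] at h4
      have h6 := mul_le_mul_of_nonneg_left h4 (hX j)
      nlinarith
    by_contra hc
    push Not at hc
    have : 0 < t * ∑ j ∈ observed X, X j * (d j / (r j + t * d j)) := mul_pos h0 hc
    linarith
  have hlim : Filter.Tendsto (fun t : ℝ => ∑ j ∈ observed X, X j * (d j / (r j + t * d j)))
      (nhdsWithin 0 (Set.Ioi 0)) (nhds (∑ j ∈ observed X, X j * (d j / r j))) := by
    refine Filter.Tendsto.mono_left ?_ nhdsWithin_le_nhds
    refine tendsto_finsetSum _ fun j hj => ?_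
    have hrj := (hT'.2 j hj).ne'
    have hc : ContinuousAt (fun t : ℝ => X j * (d j / (r j + t * d j))) 0 := by
      refine ContinuousAt.mul continuousAt_const (ContinuousAt.div continuousAt_const
        (by fun_prop) (by simpa using hrj))
    simpa using hc.tendsto
  have h7 : ∑ j ∈ observed X, X j * (d j / r j) ≤ 0 := by
    refine le_of_tendsto hlim ?_
    filter_upwards [Ioo_mem_nhdsGT (zero_lt_one' ℝ)] with t ht
    exact hineq t ht.1 ht.2
  have h8 : ∑ j ∈ observed X, X j * (d j / r j)
      = ∑ j ∈ observed X, X j * (A j k / r j) - ∑ j ∈ observed X, X j * 1 := by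
    rw [← Finset.sum_sub_distrib]
    refine Finset.sum_congr rfl fun j hj => ?_
    have hrj := (hT'.2 j hj).ne'
    rw [← hr] at hrj
    simp only [hd]
    field_simp
  rw [h8, sum_observed_mul hX, sum_observed_mul hX] at h7
  simp only [mul_one, hX1] at h7
  linarith

/-- A dual certificate: a point of the domain whose dual variables are at most `1` is a maximum
likelihood estimate, and all estimates vanish where they are smaller than `1`. -/
theorem isMLE_of_dual_certificate (hX : ∀ j, 0 ≤ X j) (hX1 : ∑ j, X j = 1)
    {T' : Fin K → ℝ} (hT' : T' ∈ likDomain A X)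
    (hdual : ∀ k, ∑ j, X j * (A j k / A.mulVec T' j) ≤ 1) :
    IsMLE A X T' ∧ ∀ T'', IsMLE A X T'' → ∀ k,
      ∑ j, X j * (A j k / A.mulVec T' j) < 1 → T'' k = 0 := by
  set Dk : Fin K → ℝ := fun k => ∑ j, X j * (A j k / A.mulVec T' j) with hDk
  have key : ∀ T'' ∈ likDomain A X,
      logLik A X T'' - logLik A X T' ≤ ∑ k, T'' k * (Dk k - 1) := by
    intro T'' hT''
    -- The tangent bound `log x ≤ x - 1` is linear in `T''`, hence a combination of the dual slacks.
    -- Equality for another maximizer forces complementary slackness.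
    have h1 : ∑ k, T'' k * (Dk k - 1)
        = ∑ j ∈ observed X, X j * (A.mulVec T'' j / A.mulVec T' j - 1) := by
      rw [sum_observed_mul hX]
      simp only [mul_sub, Finset.sum_sub_distrib, mul_one, hX1, hT''.1.2, hDk]
      congr 1
      simp only [Finset.mul_sum, mulVec_apply' T'', Finset.sum_div]
      rw [Finset.sum_comm]
      exact Finset.sum_congr rfl fun j _ => Finset.sum_congr rfl fun k _ => by ring
    rw [h1, logLik, logLik, ← Finset.sum_sub_distrib]
    refine Finset.sum_le_sum fun j hj => ?_
    have a := hT''.2 j hj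
    have b := hT'.2 j hj
    rw [← mul_sub, ← Real.log_div a.ne' b.ne']
    exact mul_le_mul_of_nonneg_left (Real.log_le_sub_one_of_pos (div_pos a b)) (hX j)
  have hneg : ∀ T'' ∈ likDomain A X, ∀ k, T'' k * (Dk k - 1) ≤ 0 := fun T'' h k =>
    mul_nonpos_of_nonneg_of_nonpos (h.1.1 k) (sub_nonpos.2 (hdual k))
  refine ⟨⟨hT', fun T'' h => ?_⟩, fun T'' h k hk => ?_⟩
  · have := key T'' h
    have h2 : ∑ k, T'' k * (Dk k - 1) ≤ 0 := Finset.sum_nonpos fun k _ => hneg T'' h k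
    linarith
  · have h1 := key T'' h.1
    have h2 := h.2 T' hT'
    have h3 : ∑ k, T'' k * (Dk k - 1) = 0 :=
      le_antisymm (Finset.sum_nonpos fun k _ => hneg T'' h.1 k) (by linarith)
    have h4 := (Finset.sum_eq_zero_iff_of_nonpos fun k _ => hneg T'' h.1 k).1 h3 k
      (Finset.mem_univ k)
    exact (mul_eq_zero.1 h4).resolve_right (sub_neg.2 hk).ne

/-- Deterministic support recovery. -/
theorem support_recovery (hA : IsWordTopic A) (hT : T ∈ stdSimplex ℝ (Fin K))
    (hX : ∀ j, 0 ≤ X j) (hX1 : ∑ j, X j = 1) (hXq : ∀ j, 0 < X j → 0 < A.mulVec T j)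
    {κ ρ B : ℝ} (hκ : 0 < κ) (hκ1 : κ ≤ 1) (hρ0 : 0 ≤ ρ) (hρ : ρ < tMin T / 8) (hB : 0 ≤ B)
    (hcond : ∀ v : Fin K → ℝ, (∀ k ∉ supp T, v k = 0) → κ * ∑ k, |v k| ≤ ∑ j, |A.mulVec v j|)
    (hquad : ∀ k ∈ supp T, ∀ l ∈ supp T, |∑ j, (X j - A.mulVec T j) *
      (scaled A (A.mulVec T) j k * scaled A (A.mulVec T) j l)| ≤ κ ^ 2 / 2)
    (hlin : ∀ v : Fin K → ℝ, (∀ k ∉ supp T, v k = 0) →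
      ∑ j, (X j - A.mulVec T j) * (A.mulVec v j / A.mulVec T j)
        ≤ ρ * κ / 6 * √(∑ j, A.mulVec v j ^ 2 / A.mulVec T j))
    (hAB : ∀ k ∉ supp T, ∀ j, 0 < A.mulVec T j → A j k ≤ B * A.mulVec T j)
    (hoff : ∀ k ∉ supp T, ∑ j, (X j - A.mulVec T j) * scaled A (A.mulVec T) j k + 3 * B * ρ
      < ∑ j ∈ (overJ (A.mulVec T))ᶜ, A j k) :
    (∃ T', IsMLE A X T') ∧ ∀ T', IsMLE A X T' → supp T' ⊆ supp T := by
  have hqs := mulVec_mem_stdSimplex hA hT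
  have hτ := tMin_pos hT
  have hdom : T ∈ likDomain A X := ⟨hT, fun j hj => hXq j (mem_observed.1 hj)⟩
  set F : Set (Fin K → ℝ) := {T' | T' ∈ stdSimplex ℝ (Fin K) ∧ ∀ k ∉ supp T, T' k = 0} with hF
  have hFc : IsCompact F := by
    refine (isCompact_stdSimplex ℝ (Fin K)).of_isClosed_subset ?_ fun _ h => h.1
    have : F = stdSimplex ℝ (Fin K) ∩ ⋂ k ∈ (supp T)ᶜ, {T' : Fin K → ℝ | T' k = 0} := by
      ext; simp [hF]
    rw [this]
    exact (isClosed_stdSimplex ℝ (Fin K)).inter (isClosed_biInter fun k _ =>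
      isClosed_eq (continuous_apply k) continuous_const)
  obtain ⟨T', hT'F, hT', hmax⟩ := exists_max_logLik hA hX hFc (fun _ h => h.1)
    (T₀ := T) ⟨hT, fun k hk => by simpa [mem_supp] using hk⟩ hdom
  have hsub : supp T' ⊆ supp T := fun k hk => by
    by_contra h
    exact mem_supp.1 hk (hT'F.2 k h)
  have hl1 := l1_dist_le hA hT hX hXq hκ hρ0 hρ hcond hquad hlin hT' hsub
    (hmax T ⟨hT, fun k hk => by simpa [mem_supp] using hk⟩ hdom)
  have hin : ∀ k ∈ supp T, ∑ j, X j * (A j k / A.mulVec T' j) ≤ 1 := fun k hk => by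
    refine sum_div_mulVec_le_one hA hX hX1 hT' fun t _ _ h => hmax _ ⟨h.1, fun l hl => ?_⟩ h
    have : l ≠ k := fun e => hl (e ▸ hk)
    simp [hT'F.2 l hl, this]
  have hout : ∀ k ∉ supp T, ∑ j, X j * (A j k / A.mulVec T' j) < 1 := fun k hk => by
    set q := A.mulVec T with hq
    set v : Fin K → ℝ := T' - T with hvdef
    have hv : ∀ k ∉ supp T, v k = 0 := fun k hk => by
      have h2 : T k = 0 := by simpa [mem_supp] using hk
      simp [hvdef, hT'F.2 k hk, h2]
    have hAv : ∀ j, A.mulVec v j = A.mulVec T' j - q j := fun j => by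
      rw [hvdef, Matrix.mulVec_sub]; rfl
    have hlb : ∀ j, q j / 2 ≤ A.mulVec T' j := fun j => by
      have h1 := (abs_le.1 (abs_mulVec_le hA hT hv j)).1
      have h2 : (∑ k, |v k|) / tMin T ≤ 1 / 2 := by
        rw [div_le_iff₀ hτ]
        change ∑ k, |v k| ≤ ρ at hl1
        linarith
      have h3 := mul_le_mul_of_nonneg_left h2 (hqs.1 j)
      rw [hAv] at h1
      linarith
    -- Since `∑ i, T i * scaled A q j i = 1` when `q j ≠ 0`, a scaled column is a `T`-average of
    -- products of two scaled columns. Hence `hquad` also bounds its deviation, by `κ ^ 2 / 2 ≤ 1 /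
    -- 2`.
    have hcol : ∀ l ∈ supp T, ∑ j, X j * scaled A q j l ≤ 3 / 2 := fun l hl => by
      have h1 : ∀ j, (X j - q j) * scaled A q j l =
          ∑ i ∈ supp T, T i * ((X j - q j) * (scaled A q j l * scaled A q j i)) := fun j => by
        have h2 : ∑ i ∈ supp T, T i * ((X j - q j) * (scaled A q j l * scaled A q j i))
            = (X j - q j) * scaled A q j l * ∑ i ∈ supp T, scaled A q j i * T i := by
          rw [Finset.mul_sum]
          exact Finset.sum_congr rfl fun i _ => by ring
        rw [h2, ← mulVec_eq_sum_of_support (S := supp T) (fun k hk => by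
          simpa [mem_supp] using hk), scaled_mulVec, ← hq]
        by_cases h : q j = 0
        · simp [h, scaled_apply]
        · rw [div_self h, mul_one]
      have h2 : ∑ j, (X j - q j) * scaled A q j l ≤ 1 / 2 := by
        calc ∑ j, (X j - q j) * scaled A q j l
            = ∑ i ∈ supp T, T i * ∑ j, (X j - q j) * (scaled A q j l * scaled A q j i) := by
              rw [Finset.sum_congr rfl fun j _ => h1 j, Finset.sum_comm]
              exact Finset.sum_congr rfl fun i _ => by rw [Finset.mul_sum]
          _ ≤ ∑ i ∈ supp T, T i * (1 / 2) := by
              refine Finset.sum_le_sum fun i hi => mul_le_mul_of_nonneg_left ?_ (hT.1 i)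
              have := (abs_le.1 (hquad l hl i hi)).2
              nlinarith
          _ ≤ ∑ i, T i * (1 / 2) := Finset.sum_le_sum_of_subset_of_nonneg
              (Finset.subset_univ _) fun i _ _ => by have := hT.1 i; positivity
          _ = 1 / 2 := by rw [← Finset.sum_mul, hT.2, one_mul]
      have h3 : ∑ j, q j * scaled A q j l ≤ 1 := by
        rw [← hA.sum_eq_one l]
        refine Finset.sum_le_sum fun j _ => ?_
        rw [scaled_apply]
        by_cases h : q j = 0
        · simpa [h] using hA.nonneg j l
        · rw [mul_div_cancel₀ _ h]
      simp only [sub_mul, Finset.sum_sub_distrib] at h2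
      linarith
    have hrem : ∑ j, X j * (|A.mulVec v j| / q j) ≤ 3 / 2 * ρ := by
      calc ∑ j, X j * (|A.mulVec v j| / q j)
          ≤ ∑ j, ∑ l ∈ supp T, |v l| * (X j * scaled A q j l) := by
            refine Finset.sum_le_sum fun j _ => ?_
            have h1 : |A.mulVec v j| ≤ ∑ l ∈ supp T, A j l * |v l| := by
              rw [mulVec_eq_sum_of_support hv]
              refine (Finset.abs_sum_le_sum_abs _ _).trans (le_of_eq ?_)
              exact Finset.sum_congr rfl fun l _ => by
                rw [abs_mul, abs_of_nonneg (hA.nonneg j l)]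
            calc X j * (|A.mulVec v j| / q j)
                ≤ X j * ((∑ l ∈ supp T, A j l * |v l|) / q j) :=
                  mul_le_mul_of_nonneg_left (div_le_div_of_nonneg_right h1 (hqs.1 j)) (hX j)
              _ = _ := by
                  rw [Finset.sum_div, Finset.mul_sum]
                  exact Finset.sum_congr rfl fun l _ => by rw [scaled_apply]; ring
        _ = ∑ l ∈ supp T, |v l| * ∑ j, X j * scaled A q j l := by
            rw [Finset.sum_comm]
            exact Finset.sum_congr rfl fun l _ => by rw [Finset.mul_sum]
        _ ≤ ∑ l ∈ supp T, |v l| * (3 / 2) := Finset.sum_le_sum fun l hl =>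
            mul_le_mul_of_nonneg_left (hcol l hl) (abs_nonneg _)
        _ ≤ ∑ l, |v l| * (3 / 2) := Finset.sum_le_sum_of_subset_of_nonneg
              (Finset.subset_univ _) fun i _ _ => by positivity
        _ ≤ 3 / 2 * ρ := by
            rw [← Finset.sum_mul]
            change ∑ l, |v l| ≤ ρ at hl1
            linarith
    have hterm : ∀ j, X j * (A j k / A.mulVec T' j) ≤
        X j * scaled A q j k + 2 * B * (X j * (|A.mulVec v j| / q j)) := fun j => by
      rcases (hX j).eq_or_lt with h0 | h0
      · simp [← h0]
      have hqj := hXq j h0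
      have hr := hlb j
      have hr0 : 0 < A.mulVec T' j := by linarith
      have h1 : A j k / A.mulVec T' j - A j k / q j ≤ 2 * B * (|A.mulVec v j| / q j) := by
        have h2 : A j k / A.mulVec T' j - A j k / q j
            = (A j k / A.mulVec T' j) * (- A.mulVec v j / q j) := by
          rw [hAv]
          field_simp
          ring
        have h3 : A j k / A.mulVec T' j ≤ 2 * B := by
          rw [div_le_iff₀ hr0]
          have := hAB k hk j hqj
          nlinarith
        have h4 : 0 ≤ A j k / A.mulVec T' j := div_nonneg (hA.nonneg j k) hr0.le
        rw [h2]
        calc (A j k / A.mulVec T' j) * (- A.mulVec v j / q j)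
            ≤ (A j k / A.mulVec T' j) * (|A.mulVec v j| / q j) :=
              mul_le_mul_of_nonneg_left
                (div_le_div_of_nonneg_right (neg_le_abs _) hqj.le) h4
          _ ≤ _ := mul_le_mul_of_nonneg_right h3 (by positivity)
      have h5 := mul_le_mul_of_nonneg_left h1 h0.le
      rw [scaled_apply]
      linarith
    have hsum := Finset.sum_le_sum fun j (_ : j ∈ Finset.univ) => hterm j
    rw [Finset.sum_add_distrib, ← Finset.mul_sum] at hsum
    -- The slack of the dual variable: the mean misses exactly the mass of topic `k` on words of
    -- probability zero.
    have hqsum : ∑ j, q j * scaled A q j k = 1 - ∑ j ∈ (overJ q)ᶜ, A j k := by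
      rw [← hA.sum_eq_one k, ← Finset.sum_add_sum_compl (overJ q) fun j => A j k,
        add_sub_cancel_right]
      refine (Finset.sum_subset (Finset.subset_univ (overJ q)) fun j _ hj => ?_).symm.trans ?_
      · rw [le_antisymm (not_lt.1 (mem_overJ.not.1 hj)) (hqs.1 j), zero_mul]
      · refine Finset.sum_congr rfl fun j hj => ?_
        rw [scaled_apply, mul_div_cancel₀ _ (mem_overJ.1 hj).ne']
    have h6 := hoff k hk
    simp only [sub_mul, Finset.sum_sub_distrib] at h6
    have h7 := mul_le_mul_of_nonneg_left hrem (by positivity : 0 ≤ 2 * B)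
    linarith
  obtain ⟨h1, h2⟩ := isMLE_of_dual_certificate hX hX1 hT' fun k => by
    by_cases hk : k ∈ supp T
    · exact hin k hk
    · exact (hout k hk).le
  refine ⟨⟨T', h1⟩, fun T'' h k hk => ?_⟩
  by_contra hc
  exact mem_supp.1 hk (h2 T'' h k (hout k hc))

end Deterministic

/-! ### Reduction of the linear noise to at most `s` directions. -/

section Directions

variable {p K : ℕ} {A : Matrix (Fin p) (Fin K) ℝ} {T : Fin K → ℝ}

/-- Directions supported in the true support whose normalised images form an orthonormal basis. -/
theorem exists_orthonormal_directions (hA : IsWordTopic A) (hT : T ∈ stdSimplex ℝ (Fin K)) :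
    ∃ d ≤ (supp T).card, ∃ z : Fin d → Fin K → ℝ, (∀ i, ∀ k ∉ supp T, z i k = 0) ∧
      (∀ i, ∑ j, A.mulVec (z i) j ^ 2 / A.mulVec T j = 1) ∧
      ∀ v : Fin K → ℝ, (∀ k ∉ supp T, v k = 0) → ∃ a : Fin d → ℝ,
        (∀ j, A.mulVec v j / A.mulVec T j = ∑ i, a i * (A.mulVec (z i) j / A.mulVec T j)) ∧
        ∑ i, a i ^ 2 = ∑ j, A.mulVec v j ^ 2 / A.mulVec T j := by
  have hqs := mulVec_mem_stdSimplex hA hT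
  set q := A.mulVec T with hq
  -- Dividing the rows by `√(q j)` makes the squared Euclidean norm equal to `χ²`. The basis is
  -- taken in the range of `Φ`, so injectivity is not needed and the dimension is at most the size
  -- of the support.
  let Φ : (supp T → ℝ) →ₗ[ℝ] EuclideanSpace ℝ (Fin p) :=
    Fintype.linearCombination ℝ fun k : supp T => WithLp.toLp 2 fun j => A j k / √(q j)
  have hΦ : ∀ v : Fin K → ℝ, (∀ k ∉ supp T, v k = 0) → ∀ j,
      Φ (fun k => v k) j = A.mulVec v j / √(q j) := fun v hv j => by
    have h1 : Φ (fun k => v k) j = ∑ k : supp T, v k * (A j k / √(q j)) := by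
      simp [Φ, Fintype.linearCombination_apply]
    rw [h1, mulVec_eq_sum_of_support hv, Finset.sum_div,
      Finset.sum_coe_sort (supp T) fun k => v k * (A j k / √(q j))]
    exact Finset.sum_congr rfl fun k _ => by ring
  have hnorm : ∀ v : Fin K → ℝ, (∀ k ∉ supp T, v k = 0) →
      ‖Φ (fun k => v k)‖ ^ 2 = ∑ j, A.mulVec v j ^ 2 / q j := fun v hv => by
    rw [EuclideanSpace.norm_sq_eq]
    refine Finset.sum_congr rfl fun j _ => ?_
    rw [hΦ v hv, Real.norm_eq_abs, sq_abs, div_pow, Real.sq_sqrt (hqs.1 j)]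
  let V := LinearMap.range Φ
  let b := stdOrthonormalBasis ℝ V
  have hb : ∀ i, ∃ w : supp T → ℝ, Φ w = (b i : EuclideanSpace ℝ (Fin p)) := fun i => (b i).2
  choose w hw using hb
  let z : Fin (Module.finrank ℝ V) → Fin K → ℝ := fun i k =>
    if h : k ∈ supp T then w i ⟨k, h⟩ else 0
  have hz : ∀ i, ∀ k ∉ supp T, z i k = 0 := fun i k hk => by simp [z, hk]
  have hzw : ∀ i, (fun k : supp T => z i k) = w i := fun i => by
    ext k; simp [z]
  refine ⟨Module.finrank ℝ V, ?_, z, hz, fun i => ?_, fun v hv => ?_⟩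
  · refine (LinearMap.finrank_range_le Φ).trans ?_
    simp
  · rw [← hnorm (z i) (hz i), hzw, hw]
    have : ‖(b i : EuclideanSpace ℝ (Fin p))‖ = 1 := b.orthonormal.1 i
    rw [this, one_pow]
  · let x : V := ⟨Φ (fun k => v k), LinearMap.mem_range_self Φ _⟩
    refine ⟨fun i => b.repr x i, fun j => ?_, ?_⟩
    · have h1 : (x : EuclideanSpace ℝ (Fin p)) =
          ∑ i, b.repr x i • (b i : EuclideanSpace ℝ (Fin p)) := by
        conv_lhs => rw [← b.sum_repr x]
        simp
      have h2 : A.mulVec v j / √(q j) = ∑ i, b.repr x i * (A.mulVec (z i) j / √(q j)) := by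
        have h3 := congrArg (fun y : EuclideanSpace ℝ (Fin p) => y j) h1
        simp only [x] at h3
        rw [hΦ v hv] at h3
        rw [h3]
        simp only [WithLp.ofLp_sum, Finset.sum_apply, WithLp.ofLp_smul, Pi.smul_apply, smul_eq_mul]
        refine Finset.sum_congr rfl fun i _ => ?_
        rw [← hw i, ← hzw i, hΦ (z i) (hz i)]
      have h4 : ∀ y : ℝ, y / q j = y / √(q j) / √(q j) := fun y => by
        rw [div_div, Real.mul_self_sqrt (hqs.1 j)]
      rw [h4, h2, Finset.sum_div]
      refine Finset.sum_congr rfl fun i _ => ?_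
      rw [h4 (A.mulVec (z i) j)]
      ring
    · rw [← hnorm v hv]
      have h5 : ‖b.repr x‖ ^ 2 = ‖Φ (fun k => v k)‖ ^ 2 := by
        rw [b.repr.norm_map]; rfl
      rw [← h5, EuclideanSpace.norm_sq_eq]
      exact Finset.sum_congr rfl fun i _ => by rw [Real.norm_eq_abs, sq_abs]

/-- Linear functionals are controlled by their values on orthonormal directions. -/
theorem sum_mul_le_of_directions {d s : ℕ} (hd : d ≤ s) {z : Fin d → Fin K → ℝ} {t : ℝ} (ht : 0 ≤ t)
    {W q : Fin p → ℝ} (hz : ∀ i, |∑ j, W j * (A.mulVec (z i) j / q j)| ≤ t) {v : Fin K → ℝ}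
    {a : Fin d → ℝ} {χ : ℝ}
    (h1 : ∀ j, A.mulVec v j / q j = ∑ i, a i * (A.mulVec (z i) j / q j))
    (h2 : ∑ i, a i ^ 2 = χ) :
    ∑ j, W j * (A.mulVec v j / q j) ≤ √s * t * √χ := by
  set ζ : Fin d → ℝ := fun i => ∑ j, W j * (A.mulVec (z i) j / q j) with hζ
  have h3 : ∑ j, W j * (A.mulVec v j / q j) = ∑ i, a i * ζ i := by
    simp only [h1, hζ, Finset.mul_sum]
    rw [Finset.sum_comm]
    exact Finset.sum_congr rfl fun i _ => Finset.sum_congr rfl fun j _ => by ring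
  have h4 : ∑ i, ζ i ^ 2 ≤ s * t ^ 2 := by
    calc ∑ i, ζ i ^ 2 ≤ ∑ _i : Fin d, t ^ 2 := Finset.sum_le_sum fun i _ =>
          sq_le_sq' (by linarith [(abs_le.1 (hz i)).1]) (abs_le.1 (hz i)).2
      _ = d * t ^ 2 := by simp
      _ ≤ s * t ^ 2 := by gcongr
  calc ∑ j, W j * (A.mulVec v j / q j) ≤ √(∑ i, a i ^ 2) * √(∑ i, ζ i ^ 2) := by
        rw [h3]; exact Real.sum_mul_le_sqrt_mul_sqrt _ _ _
    _ ≤ √χ * √(s * t ^ 2) := by rw [h2]; gcongr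
    _ = √s * t * √χ := by
        rw [Real.sqrt_mul (Nat.cast_nonneg s), Real.sqrt_sq ht]; ring

end Directions

/-! ### Comparison of the Bernstein levels with the sample size and incoherence conditions. -/

section Numerics

theorem exp_neg_mul_log {m : ℕ} (hm : 1 ≤ m) (k : ℕ) :
    Real.exp (-(k * Real.log m)) = ((m : ℝ) ^ k)⁻¹ := by
  rw [Real.exp_neg, ← Real.log_pow, Real.exp_log (by positivity)]

/-- Bernstein level for products of two scaled columns: variance `τ⁻³`, bound `τ⁻²`, `L = 4 log m`,
`x = log m / N`. The variance term dictates the factor `κ ^ 4 * τ ^ 3` in the sample size condition.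
-/
theorem quadratic_level_le {κ τ x : ℝ} (hκ0 : 0 < κ) (hκ1 : κ ≤ 1) (hτ0 : 0 < τ) (hτ1 : τ ≤ 1)
    (hx : x ≤ κ ^ 4 * τ ^ 3 / 10 ^ 6) :
    2 * √(1 / τ ^ 3) * √(4 * x) + 2 * (1 / τ ^ 2) * (4 * x) ≤ κ ^ 2 / 2 := by
  have h1 : √(1 / τ ^ 3) * √(4 * x) ≤ 2 * κ ^ 2 / 1000 := by
    rw [← Real.sqrt_mul (by positivity)]
    refine Real.sqrt_le_iff.2 ⟨by positivity, ?_⟩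
    calc 1 / τ ^ 3 * (4 * x) ≤ 1 / τ ^ 3 * (4 * (κ ^ 4 * τ ^ 3 / 10 ^ 6)) := by gcongr
      _ = _ := by field_simp; norm_num
  have h2 : 2 * (1 / τ ^ 2) * (4 * x) ≤ 8 * κ ^ 2 / 10 ^ 6 := by
    calc 2 * (1 / τ ^ 2) * (4 * x) ≤ 2 * (1 / τ ^ 2) * (4 * (κ ^ 4 * τ ^ 3 / 10 ^ 6)) := by gcongr
      _ = 8 * κ ^ 2 / 10 ^ 6 * (κ ^ 2 * τ) := by field_simp; norm_num
      _ ≤ 8 * κ ^ 2 / 10 ^ 6 * 1 := by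
          gcongr
          exact mul_le_one₀ (pow_le_one₀ hκ0.le hκ1) hτ0.le hτ1
      _ = _ := by ring
  nlinarith [sq_nonneg κ]

/-- Bernstein level for a normalised direction: variance `1`, bound `1 / (κ * τ)`. The variance term
is `4 * √x`, and the other one is at most `√x`. -/
theorem linear_level_le {κ τ x : ℝ} (hκ0 : 0 < κ) (hκ1 : κ ≤ 1) (hτ0 : 0 < τ) (hτ1 : τ ≤ 1)
    (hx0 : 0 ≤ x) (hx : x ≤ κ ^ 4 * τ ^ 3 / 10 ^ 6) :
    2 * 1 * √(4 * x) + 2 * (1 / (κ * τ)) * (4 * x) ≤ 5 * √x := by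
  have h1 : √(4 * x) = 2 * √x := by
    rw [Real.sqrt_mul (by norm_num), show (4 : ℝ) = 2 ^ 2 by norm_num,
      Real.sqrt_sq (by norm_num)]
  have h2 : √x ≤ κ * τ / 1000 := by
    refine Real.sqrt_le_iff.2 ⟨by positivity, hx.trans ?_⟩
    calc κ ^ 4 * τ ^ 3 / 10 ^ 6 = (κ * τ / 1000) ^ 2 * (κ ^ 2 * τ) := by ring
      _ ≤ (κ * τ / 1000) ^ 2 * 1 := by
          gcongr
          exact mul_le_one₀ (pow_le_one₀ hκ0.le hκ1) hτ0.le hτ1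
      _ = _ := by ring
  have h3 : 2 * (1 / (κ * τ)) * (4 * x) ≤ √x := by
    calc 2 * (1 / (κ * τ)) * (4 * x) = 8 * (1 / (κ * τ)) * √x * √x := by
          nth_rewrite 1 [← Real.mul_self_sqrt hx0]; ring
      _ ≤ 8 * (1 / (κ * τ)) * (κ * τ / 1000) * √x := by gcongr
      _ = 8 / 1000 * √x := by field_simp
      _ ≤ √x := by linarith [Real.sqrt_nonneg x]
  rw [h1]
  linarith

/-- The left side is the radius `ρ`. The factor `s` is paid for by one power of `τ`, through `s * τ
≤ 1`. -/
theorem l1_radius_lt {κ τ s x : ℝ} (hκ0 : 0 < κ) (hκ1 : κ ≤ 1) (hτ0 : 0 < τ) (hs0 : 0 ≤ s)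
    (hsτ : s * τ ≤ 1) (hx : x ≤ κ ^ 4 * τ ^ 3 / 10 ^ 6) :
    30 * κ⁻¹ * (√s * √x) < τ / 8 := by
  have h : √s * √x ≤ κ * τ / 1000 := by
    rw [← Real.sqrt_mul hs0]
    refine Real.sqrt_le_iff.2 ⟨by positivity, ?_⟩
    calc s * x ≤ s * (κ ^ 4 * τ ^ 3 / 10 ^ 6) := by gcongr
      _ = (κ * τ / 1000) ^ 2 * (κ ^ 2 * (s * τ)) := by ring
      _ ≤ (κ * τ / 1000) ^ 2 * 1 := by
          gcongr
          exact mul_le_one₀ (pow_le_one₀ hκ0.le hκ1) (by positivity) hsτ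
      _ = _ := by ring
  calc 30 * κ⁻¹ * (√s * √x) ≤ 30 * κ⁻¹ * (κ * τ / 1000) := by gcongr
    _ = 30 / 1000 * τ := by field_simp
    _ < τ / 8 := by linarith

/-- With `r = √(B * y)`, incoherence bounds both `r` and `κ⁻¹ * √(B * s) * r` by `o / 1000`. The
fluctuation is at most `8 * r` and the replacement cost `3 * B * ρ` at most 90 times the second
quantity. -/
theorem off_support_level_lt {B κ s y x o : ℝ} (hB : 0 < B) (hκ0 : 0 < κ)
    (hy0 : 0 < y) (hxy : x ≤ y) (ho1 : o ≤ 1)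
    (h : (κ⁻¹ * √(B * s) + 1) * √(B * y) ≤ 1 / 1000 * o) :
    2 * √B * √(2 * y) + 2 * B * (2 * y) + 3 * B * (30 * κ⁻¹ * (√s * √x)) < o := by
  set r := √(B * y) with hr
  have hr0 : 0 < r := Real.sqrt_pos.2 (by positivity)
  have hr2 : r ^ 2 = B * y := Real.sq_sqrt (by positivity)
  have h1 : 0 ≤ κ⁻¹ * √(B * s) * r := by positivity
  have h2 : r ≤ 1 / 1000 * o := by nlinarith
  have h3 : κ⁻¹ * √(B * s) * r ≤ 1 / 1000 * o := by nlinarith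
  have h4 : √B * √(2 * y) ≤ 2 * r := by
    rw [← Real.sqrt_mul hB.le]
    refine Real.sqrt_le_iff.2 ⟨by positivity, ?_⟩
    nlinarith
  have h5 : B * (√s * √x) ≤ √(B * s) * r := by
    calc B * (√s * √x) ≤ B * (√s * √y) := by gcongr
      _ = √(B * s) * r := by
          rw [hr, Real.sqrt_mul hB.le, Real.sqrt_mul hB.le]
          nth_rewrite 1 [← Real.mul_self_sqrt hB.le]
          ring
  have h6 : 3 * B * (30 * κ⁻¹ * (√s * √x)) ≤ 90 * (κ⁻¹ * √(B * s) * r) := by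
    calc 3 * B * (30 * κ⁻¹ * (√s * √x)) = 90 * κ⁻¹ * (B * (√s * √x)) := by ring
      _ ≤ 90 * κ⁻¹ * (√(B * s) * r) := by gcongr
      _ = _ := by ring
  have h7 : r ≤ 1 := by linarith
  have h8 : B * y ≤ r := by nlinarith
  nlinarith

end Numerics

/-! ### Probability of the failure events. -/

section Words

variable {p K N : ℕ} {A : Matrix (Fin p) (Fin K) ℝ} {T : Fin K → ℝ}

theorem freq_nonneg (y : Fin p → ℕ) (j : Fin p) : 0 ≤ freq N y j := by
  rw [freq]; positivity

theorem sum_freq_wordCount (hN : 0 < N) (w : Fin N → Fin p) :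
    ∑ j, freq N (wordCount w) j = 1 := by
  have h := sum_freq_wordCount_mul w fun _ => (1 : ℝ)
  simp only [mul_one, Finset.sum_const, Finset.card_univ, Fintype.card_fin, nsmul_eq_mul] at h
  rw [h, div_self (by positivity)]

/-- Concentration of the second moments of the scaled columns in the support. -/
theorem measureReal_quadratic_le (hA : IsWordTopic A) (hT : T ∈ stdSimplex ℝ (Fin K)) (hN : 0 < N)
    {κ : ℝ} (hκ0 : 0 < κ) (hκ1 : κ ≤ 1) {m : ℕ} (hm : 1 ≤ m)
    (hx : Real.log m / N ≤ κ ^ 4 * tMin T ^ 3 / 10 ^ 6) {k l : Fin K} (hk : k ∈ supp T)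
    (hl : l ∈ supp T) :
    (Measure.pi fun _ : Fin N => wordLaw (A.mulVec T)).real
      {w | κ ^ 2 / 2 ≤ |∑ j, (freq N (wordCount w) j - A.mulVec T j) *
        (scaled A (A.mulVec T) j k * scaled A (A.mulVec T) j l)|} ≤ 2 * ((m : ℝ) ^ 4)⁻¹ := by
  have hqs := mulVec_mem_stdSimplex hA hT
  have hpr := wordLaw_isProbabilityMeasure hqs
  have hτ := tMin_pos hT
  set q := A.mulVec T with hq
  set τ := tMin T
  have hL : 0 ≤ 4 * Real.log m := by
    have := Real.log_natCast_nonneg m; positivity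
  have hs : ∀ i ∈ supp T, ∀ j, 0 ≤ scaled A q j i ∧ scaled A q j i ≤ 1 / τ := fun i hi j => by
    rw [scaled_apply]
    refine ⟨div_nonneg (hA.nonneg j i) (hqs.1 j), ?_⟩
    rcases (hqs.1 j).eq_or_lt with h | h
    · rw [← h, div_zero]; positivity
    · rw [div_le_iff₀ h]
      have := entry_le_div_tMin hA hT j hi
      rw [← hq] at this
      refine this.trans (le_of_eq (by ring))
  have hprod : ∀ j, scaled A q j k * scaled A q j l ≤ 1 / τ ^ 2 := fun j => by
    calc scaled A q j k * scaled A q j l ≤ 1 / τ * (1 / τ) :=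
          mul_le_mul (hs k hk j).2 (hs l hl j).2 (hs l hl j).1 (by positivity)
      _ = _ := by field_simp
  have h := freq_bernstein_abs (N := N) hqs hN (f := fun j => scaled A q j k * scaled A q j l)
    (σ := √(1 / τ ^ 3)) (b := 1 / τ ^ 2) (L := 4 * Real.log m) (by positivity) (by positivity) hL
    (fun j => by rw [abs_of_nonneg (mul_nonneg (hs k hk j).1 (hs l hl j).1)]; exact hprod j) (by
      rw [Real.sq_sqrt (by positivity)]
      calc ∑ j, q j * (scaled A q j k * scaled A q j l) ^ 2
          ≤ ∑ j, A j k * (1 / τ ^ 3) := by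
            refine Finset.sum_le_sum fun j _ => ?_
            have h1 : q j * scaled A q j k ≤ A j k := by
              rw [scaled_apply]
              by_cases h : q j = 0
              · simpa [h] using hA.nonneg j k
              · rw [mul_div_cancel₀ _ h]
            have h2 : scaled A q j l * (scaled A q j k * scaled A q j l) ≤ 1 / τ ^ 3 := by
              calc scaled A q j l * (scaled A q j k * scaled A q j l) ≤ 1 / τ * (1 / τ ^ 2) :=
                    mul_le_mul (hs l hl j).2 (hprod j)
                      (mul_nonneg (hs k hk j).1 (hs l hl j).1) (by positivity)
                _ = _ := by field_simp
            calc q j * (scaled A q j k * scaled A q j l) ^ 2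
                = (q j * scaled A q j k) *
                  (scaled A q j l * (scaled A q j k * scaled A q j l)) := by ring
              _ ≤ _ := mul_le_mul h1 h2 (mul_nonneg (hs l hl j).1
                  (mul_nonneg (hs k hk j).1 (hs l hl j).1)) (hA.nonneg j k)
        _ = 1 / τ ^ 3 := by rw [← Finset.sum_mul, hA.sum_eq_one, one_mul])
  have he := exp_neg_mul_log hm 4
  norm_num only [Nat.cast_ofNat] at he
  rw [he] at h
  refine le_trans (measureReal_mono ?_ (measure_ne_top _ _)) h
  intro w hw
  simp only [Set.mem_ofPred_eq] at hw ⊢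
  refine le_trans ?_ hw
  rw [mul_div_assoc]
  exact quadratic_level_le hκ0 hκ1 hτ (tMin_le_one hT) hx

/-- Concentration of a normalised linear functional. -/
theorem measureReal_linear_le (hA : IsWordTopic A) (hT : T ∈ stdSimplex ℝ (Fin K)) (hN : 0 < N)
    {κ : ℝ} (hκ0 : 0 < κ) (hκ1 : κ ≤ 1) {M : ℕ} (hM : 1 ≤ M)
    (hx : Real.log M / N ≤ κ ^ 4 * tMin T ^ 3 / 10 ^ 6)
    (hcond : ∀ v : Fin K → ℝ, (∀ k ∉ supp T, v k = 0) → κ * ∑ k, |v k| ≤ ∑ j, |A.mulVec v j|)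
    {z : Fin K → ℝ} (hz : ∀ k ∉ supp T, z k = 0)
    (hz1 : ∑ j, A.mulVec z j ^ 2 / A.mulVec T j = 1) :
    (Measure.pi fun _ : Fin N => wordLaw (A.mulVec T)).real
      {w | 5 * √(Real.log M / N) ≤ |∑ j, (freq N (wordCount w) j - A.mulVec T j) *
        (A.mulVec z j / A.mulVec T j)|} ≤ 2 * ((M : ℝ) ^ 4)⁻¹ := by
  have hqs := mulVec_mem_stdSimplex hA hT
  have hpr := wordLaw_isProbabilityMeasure hqs
  have hτ := tMin_pos hT
  have hlog := Real.log_natCast_nonneg M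
  have hl1 : ∑ k, |z k| ≤ 1 / κ := by
    have h1 := sq_sum_abs_mulVec_le hA hT hz
    rw [hz1] at h1
    have h2 := hcond z hz
    have h3 : ∑ j, |A.mulVec z j| ≤ 1 := by
      have : 0 ≤ ∑ j, |A.mulVec z j| := Finset.sum_nonneg fun _ _ => abs_nonneg _
      nlinarith
    rw [le_div_iff₀ hκ0, mul_comm]
    linarith
  have h := freq_bernstein_abs (N := N) hqs hN (f := fun j => A.mulVec z j / A.mulVec T j)
    (σ := 1) (b := 1 / (κ * tMin T)) (L := 4 * Real.log M) one_pos (by positivity)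
    (by positivity) (fun j => by
      rcases (hqs.1 j).eq_or_lt with h | h
      · rw [← h, div_zero, abs_zero]; positivity
      · rw [abs_div, abs_of_pos h, div_le_iff₀ h]
        refine (abs_mulVec_le hA hT hz j).trans ?_
        rw [mul_comm]
        refine mul_le_mul_of_nonneg_right ?_ h.le
        calc (∑ k, |z k|) / tMin T ≤ 1 / κ / tMin T := by gcongr
          _ = _ := by field_simp) (by
      rw [one_pow, ← hz1]
      refine le_of_eq (Finset.sum_congr rfl fun j _ => ?_)
      by_cases h : A.mulVec T j = 0
      · simp [h]
      · field_simp)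
  have he := exp_neg_mul_log hM 4
  norm_num only [Nat.cast_ofNat] at he
  rw [he] at h
  refine le_trans (measureReal_mono ?_ (measure_ne_top _ _)) h
  intro w hw
  simp only [Set.mem_ofPred_eq] at hw ⊢
  refine le_trans ?_ hw
  rw [mul_div_assoc]
  exact linear_level_le hκ0 hκ1 hτ (tMin_le_one hT) (by positivity) hx

/-- Concentration of the scaled columns off the support. -/
theorem measureReal_off_support_le (hA : IsWordTopic A) (hT : T ∈ stdSimplex ℝ (Fin K))
    (hN : 0 < N) (hK : 2 ≤ K) {κ : ℝ} (hκ0 : 0 < κ) {s x : ℝ}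
    (hx : x ≤ Real.log K / N)
    (h : (κ⁻¹ * √(xi A T * s / tMin T) + 1) * √(xi A T * Real.log K / (tMin T * N))
      ≤ 1 / 1000 * offMass A T) {k : Fin K} (hk : k ∉ supp T) :
    (Measure.pi fun _ : Fin N => wordLaw (A.mulVec T)).real
      {w | ∑ j ∈ (overJ (A.mulVec T))ᶜ, A j k ≤
        ∑ j, (freq N (wordCount w) j - A.mulVec T j) * scaled A (A.mulVec T) j k
          + 3 * (xi A T / tMin T) * (30 * κ⁻¹ * (√s * √x))} ≤ ((K : ℝ) ^ 2)⁻¹ := by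
  have hqs := mulVec_mem_stdSimplex hA hT
  have hpr := wordLaw_isProbabilityMeasure hqs
  have hτ := tMin_pos hT
  set q := A.mulVec T with hq
  set τ := tMin T
  have hAB : ∀ j, 0 < q j → A j k ≤ xi A T / τ * q j := fun j hj => entry_le_xi_div_tMin hA hT hj hk
  have hN' : (0 : ℝ) < N := by exact_mod_cast hN
  have hlog : 0 < Real.log K := Real.log_pos (by exact_mod_cast hK)
  have hsplit := Finset.sum_add_sum_compl (overJ q) fun j => A j k
  rw [hA.sum_eq_one] at hsplit
  -- Bernstein needs a positive bound `B`. If `ξ = 0`, topic `k` lives entirely on words of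
  -- probability zero, so the event reads `1 ≤ 0` and is empty.
  rcases (xi_nonneg (A := A) (T := T)).eq_or_lt with h0 | h0
  · have hz : ∀ j, 0 < q j → A j k = 0 := fun j hj => by
      have := hAB j hj
      rw [← h0, zero_div, zero_mul] at this
      exact le_antisymm this (hA.nonneg j k)
    have hz' : ∀ j, scaled A q j k = 0 := fun j => by
      rw [scaled_apply]
      rcases (hqs.1 j).eq_or_lt with h | h
      · rw [← h, div_zero]
      · rw [hz j h, zero_div]
    rw [Finset.sum_eq_zero fun j hj => hz j (mem_overJ.1 hj), zero_add] at hsplit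
    have hempty : {w : Fin N → Fin p | ∑ j ∈ (overJ q)ᶜ, A j k ≤
        ∑ j, (freq N (wordCount w) j - q j) * scaled A q j k
          + 3 * (xi A T / τ) * (30 * κ⁻¹ * (√s * √x))} = ∅ := by
      refine Set.eq_empty_of_forall_notMem fun w hw => ?_
      simp only [Set.mem_ofPred_eq, hz', mul_zero, Finset.sum_const_zero, ← h0, zero_div, zero_mul,
        add_zero, hsplit] at hw
      linarith
    rw [hempty, measureReal_empty]
    positivity
  · set B := xi A T / τ with hBdef
    have hB : 0 < B := by positivity
    have hsc : ∀ j, scaled A q j k ≤ B := fun j => by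
      rw [scaled_apply]
      rcases (hqs.1 j).eq_or_lt with h | h
      · rw [← h, div_zero]; exact hB.le
      · rw [div_le_iff₀ h]; exact hAB j h
    have hb := freq_bernstein (N := N) hqs hN (f := fun j => scaled A q j k)
      (σ := √B) (b := B) (L := 2 * Real.log K) (by positivity) hB (by positivity) hsc (by
        rw [Real.sq_sqrt hB.le]
        calc ∑ j, q j * scaled A q j k ^ 2 ≤ ∑ j, A j k * B := by
              refine Finset.sum_le_sum fun j _ => ?_
              have h1 : q j * scaled A q j k ≤ A j k := by
                rw [scaled_apply]
                by_cases h : q j = 0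
                · simpa [h] using hA.nonneg j k
                · rw [mul_div_cancel₀ _ h]
              rw [sq, ← mul_assoc]
              exact mul_le_mul h1 (hsc j)
                (by rw [scaled_apply]; exact div_nonneg (hA.nonneg j k) (hqs.1 j)) (hA.nonneg j k)
          _ = B := by rw [← Finset.sum_mul, hA.sum_eq_one, one_mul])
    have he := exp_neg_mul_log (by omega : 1 ≤ K) 2
    norm_num only [Nat.cast_ofNat] at he
    rw [he] at hb
    refine le_trans (measureReal_mono ?_ (measure_ne_top _ _)) hb
    have hoff := offMass_le (A := A) hk
    rw [← hq] at hoff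
    have ho1 : offMass A T ≤ 1 := hoff.trans (by
      have : 0 ≤ ∑ j ∈ overJ q, A j k := Finset.sum_nonneg fun j _ => hA.nonneg j k
      linarith)
    have h' : (κ⁻¹ * √(B * s) + 1) * √(B * (Real.log K / N)) ≤ 1 / 1000 * offMass A T := by
      refine le_trans (le_of_eq ?_) h
      have e1 : xi A T * s / τ = B * s := by rw [hBdef]; ring
      have e2 : xi A T * Real.log K / (τ * N) = B * (Real.log K / N) := by rw [hBdef]; field_simp
      rw [e1, e2]
    have hlt := off_support_level_lt hB hκ0 (by positivity) hx ho1 h'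
    intro w hw
    simp only [Set.mem_ofPred_eq, mul_div_assoc] at hw ⊢
    linarith

/-- The probability that support recovery fails. -/
theorem measureReal_not_recovery_le (hA : IsWordTopic A) (hT : T ∈ stdSimplex ℝ (Fin K))
    (hN : 0 < N) {n : ℕ} (hsK : (supp T).card < K) {J : Finset (Fin p)}
    (hκ0 : 0 < kappa A J (supp T).card)
    (hsample : 10 ^ 6 * (Real.log (max (supp T).card n : ℕ) /
      (kappa A J (supp T).card ^ 4 * tMin T ^ 3)) ≤ (N : ℝ))
    (hinc : ((kappa A J (supp T).card)⁻¹ * √(xi A T * (supp T).card / tMin T) + 1) *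
      √(xi A T * Real.log K / (tMin T * N)) ≤ 1 / 1000 * offMass A T) :
    (Measure.pi fun _ : Fin N => wordLaw (A.mulVec T)).real
      {w | ¬ ((∃ T', IsMLE A (freq N (wordCount w)) T') ∧
        ∀ T', IsMLE A (freq N (wordCount w)) T' → supp T' ⊆ supp T)}
      ≤ 4 / ((max (supp T).card n : ℕ) : ℝ) + 4 / (K : ℝ) := by
  have hqs := mulVec_mem_stdSimplex hA hT
  have hpr := wordLaw_isProbabilityMeasure hqs
  have hτ := tMin_pos hT
  have hs1 : 1 ≤ (supp T).card := (supp_nonempty hT).card_pos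
  set s := (supp T).card with hs
  set m := max s n with hm
  set κ := kappa A J s with hκ
  set q := A.mulVec T with hq
  set τ := tMin T
  set W := Measure.pi fun _ : Fin N => wordLaw q with hW
  have hm1 : 1 ≤ m := hs1.trans (le_max_left _ _)
  have hN' : (0 : ℝ) < N := by exact_mod_cast hN
  have hκ1 : κ ≤ 1 := kappa_le_one hA hs1 ⟨0, by omega⟩
  have hcond : ∀ v : Fin K → ℝ, (∀ k ∉ supp T, v k = 0) →
      κ * ∑ k, |v k| ≤ ∑ j, |A.mulVec v j| := fun v hv => kappa_mul_le le_rfl hv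
  have hxm : Real.log m / N ≤ κ ^ 4 * τ ^ 3 / 10 ^ 6 := by
    rw [← mul_div_assoc, div_le_iff₀ (by positivity)] at hsample
    rw [div_le_div_iff₀ hN' (by norm_num)]
    linarith
  -- The linear noise enters both conditions: its logarithm must be at most `log m` for the sample
  -- size and at most `log K` for incoherence. The minimum satisfies both, still exceeds the number
  -- of directions, and costs `2 / M ≤ 2 / m + 2 / K`.
  set M := min m K with hM
  have hM1 : 1 ≤ M := le_min hm1 (by omega)
  have hsM : s ≤ M := le_min (le_max_left _ _) hsK.le
  have hlogM : Real.log M ≤ Real.log m :=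
    Real.log_le_log (by exact_mod_cast hM1) (by exact_mod_cast min_le_left _ _)
  have hlogK : Real.log M ≤ Real.log K :=
    Real.log_le_log (by exact_mod_cast hM1) (by exact_mod_cast min_le_right _ _)
  have hxM : Real.log M / N ≤ κ ^ 4 * τ ^ 3 / 10 ^ 6 :=
    (div_le_div_of_nonneg_right hlogM hN'.le).trans hxm
  set x := Real.log M / N with hx
  -- Chosen so that `ρ * κ / 6 = √s * (5 * √x)`, the linear noise level over all directions.
  set ρ := 30 * κ⁻¹ * (√s * √x) with hρ
  obtain ⟨d, hd, z, hz, hz1, hzv⟩ := exists_orthonormal_directions hA hT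
  set E₀ : Set (Fin N → Fin p) := {w | ∃ j, 0 < freq N (wordCount w) j ∧ q j = 0}
  set E₁ : Set (Fin N → Fin p) := ⋃ i ∈ supp T ×ˢ supp T,
    {w | κ ^ 2 / 2 ≤ |∑ j, (freq N (wordCount w) j - q j) *
        (scaled A q j i.1 * scaled A q j i.2)|} with hE1
  set E₂ : Set (Fin N → Fin p) := ⋃ i ∈ (Finset.univ : Finset (Fin d)),
    {w | 5 * √x ≤ |∑ j, (freq N (wordCount w) j - q j) * (A.mulVec (z i) j / q j)|} with hE2
  set E₃ : Set (Fin N → Fin p) := ⋃ k ∈ (supp T)ᶜ, {w | ∑ j ∈ (overJ q)ᶜ, A j k ≤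
        ∑ j, (freq N (wordCount w) j - q j) * scaled A q j k + 3 * (xi A T / τ) * ρ} with hE3
  have hsub : {w | ¬ ((∃ T', IsMLE A (freq N (wordCount w)) T') ∧
        ∀ T', IsMLE A (freq N (wordCount w)) T' → supp T' ⊆ supp T)} ⊆ E₀ ∪ E₁ ∪ E₂ ∪ E₃ := by
    intro w hw
    by_contra hc
    simp only [Set.mem_union, not_or] at hc
    obtain ⟨⟨⟨h0, h1⟩, h2⟩, h3⟩ := hc
    refine hw (support_recovery hA hT (freq_nonneg _) (sum_freq_wordCount hN w) (fun j hj => ?_)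
      hκ0 hκ1 (ρ := ρ) (B := xi A T / τ) (by positivity)
      (l1_radius_lt hκ0 hκ1 hτ (Nat.cast_nonneg _) (card_mul_tMin_le_one hT) hxM)
      (div_nonneg xi_nonneg hτ.le) hcond (fun k hk l hl => ?_) (fun v hv => ?_)
      (fun k hk j hj => entry_le_xi_div_tMin hA hT hj hk) fun k hk => ?_)
    · refine lt_of_le_of_ne (hqs.1 j) fun h => h0 ⟨j, hj, h.symm⟩
    · by_contra hcon
      exact h1 (Set.mem_biUnion (x := (k, l)) (by simp [hk, hl]) (not_le.1 hcon).le)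
    · obtain ⟨a, ha1, ha2⟩ := hzv v hv
      refine (sum_mul_le_of_directions hd (t := 5 * √x) (by positivity) (fun i => ?_)
        ha1 ha2).trans (le_of_eq ?_)
      · by_contra hcon
        exact h2 (Set.mem_biUnion (x := i) (by simp) (not_le.1 hcon).le)
      · rw [hρ]
        field_simp
        ring
    · by_contra hcon
      exact h3 (Set.mem_biUnion (x := k) (by simpa using hk) (not_lt.1 hcon))
  have b0 : W.real E₀ = 0 := measureReal_exists_not_mem_overJ hqs
  have b1 : W.real E₁ ≤ 2 / m := by
    refine (measureReal_biUnion_finset_le _ _).trans ?_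
    refine (Finset.sum_le_card_nsmul _ _ (2 * ((m : ℝ) ^ 4)⁻¹) fun i hi => ?_).trans ?_
    · rw [Finset.mem_product] at hi
      exact measureReal_quadratic_le hA hT hN hκ0 hκ1 hm1 hxm hi.1 hi.2
    · rw [Finset.card_product, nsmul_eq_mul, Nat.cast_mul, ← hs]
      have h1 : (s : ℝ) ≤ m := by exact_mod_cast le_max_left _ _
      have h2 : (1 : ℝ) ≤ m := by exact_mod_cast hm1
      calc (s : ℝ) * s * (2 * ((m : ℝ) ^ 4)⁻¹) ≤ m * m * (2 * ((m : ℝ) ^ 4)⁻¹) := by gcongr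
        _ = 2 / m * (m : ℝ)⁻¹ := by field_simp
        _ ≤ 2 / m * 1 := by gcongr; exact inv_le_one_of_one_le₀ h2
        _ = 2 / m := mul_one _
  have b2 : W.real E₂ ≤ 2 / m + 2 / K := by
    refine (measureReal_biUnion_finset_le _ _).trans ?_
    refine (Finset.sum_le_card_nsmul _ _ (2 * ((M : ℝ) ^ 4)⁻¹) fun i _ => ?_).trans ?_
    · exact measureReal_linear_le hA hT hN hκ0 hκ1 hM1 hxM hcond (hz i) (hz1 i)
    · rw [Finset.card_univ, Fintype.card_fin, nsmul_eq_mul]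
      have h1 : (d : ℝ) ≤ M := by exact_mod_cast hd.trans hsM
      have h2 : (1 : ℝ) ≤ M := by exact_mod_cast hM1
      calc (d : ℝ) * (2 * ((M : ℝ) ^ 4)⁻¹) ≤ M * (2 * ((M : ℝ) ^ 4)⁻¹) := by gcongr
        _ = 2 / M * ((M : ℝ) ^ 2)⁻¹ := by field_simp
        _ ≤ 2 / M * 1 := by gcongr; exact inv_le_one_of_one_le₀ (one_le_pow₀ h2)
        _ = 2 / M := mul_one _
        _ ≤ 2 / m + 2 / K := by
            rcases min_choice m K with h | h
            · rw [hM, h]; exact le_add_of_nonneg_right (by positivity)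
            · rw [hM, h]; exact le_add_of_nonneg_left (div_nonneg two_pos.le m.cast_nonneg)
  have b3 : W.real E₃ ≤ 1 / K := by
    refine (measureReal_biUnion_finset_le _ _).trans ?_
    refine (Finset.sum_le_card_nsmul _ _ (((K : ℝ) ^ 2)⁻¹) fun k hk => ?_).trans ?_
    · exact measureReal_off_support_le hA hT hN (by omega) hκ0
        (div_le_div_of_nonneg_right hlogK hN'.le) hinc (by simpa using hk)
    · have h1 : (((supp T)ᶜ.card : ℕ) : ℝ) ≤ K :=
        Nat.cast_le.2 ((Finset.card_le_univ _).trans (Fintype.card_fin K).le)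
      have h2 : (0 : ℝ) < K := Nat.cast_pos.2 (by omega)
      rw [nsmul_eq_mul]
      calc _ ≤ (K : ℝ) * ((K : ℝ) ^ 2)⁻¹ := by gcongr
        _ = _ := by field_simp
  have hu : W.real (E₀ ∪ E₁ ∪ E₂ ∪ E₃) ≤ W.real E₀ + W.real E₁ + W.real E₂ + W.real E₃ := by
    refine (measureReal_union_le _ _).trans (add_le_add ?_ le_rfl)
    refine (measureReal_union_le _ _).trans (add_le_add ?_ le_rfl)
    exact measureReal_union_le _ _
  have h4 : 4 / (m : ℝ) = 2 / m + 2 / m := by ring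
  have h5 : 4 / (K : ℝ) = 2 / K + 1 / K + 1 / K := by ring
  have h6 : (0 : ℝ) ≤ 1 / K := by positivity
  refine (measureReal_mono hsub (measure_ne_top _ _)).trans (hu.trans ?_)
  linarith

end Words

end TopicModel

theorem theorem3 :
    ∃ C > (0 : ℝ), ∃ c > (0 : ℝ),
      ∀ (p K s n N : ℕ), 1 ≤ s → s < K → 1 ≤ n → 1 ≤ N →
      ∀ (A : Matrix (Fin p) (Fin K) ℝ), TopicModel.IsWordTopic A →
      ∀ (T : Fin K → ℝ), T ∈ stdSimplex ℝ (Fin K) → (TopicModel.supp T).card = s →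
      ∀ (Ω : Type*) (_ : MeasurableSpace Ω) (P : Measure Ω) (_ : IsProbabilityMeasure P)
        (Y : Ω → Fin p → ℕ), HasLaw Y (TopicModel.multinomial N (A.mulVec T)) P →
      -- the restricted condition number is positive, so that its inverse makes sense
      0 < TopicModel.kappa A (TopicModel.underJ N (A.mulVec T)) s →
      -- the sample size condition
      C * (Real.log (max s n : ℕ) /
          (TopicModel.kappa A (TopicModel.underJ N (A.mulVec T)) s ^ 4 * TopicModel.tMin T ^ 3))
        ≤ (N : ℝ) →
      -- the incoherence condition
      ((TopicModel.kappa A (TopicModel.underJ N (A.mulVec T)) s)⁻¹ *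
            Real.sqrt (TopicModel.xi A T * s / TopicModel.tMin T) + 1) *
          Real.sqrt (TopicModel.xi A T * Real.log K / (TopicModel.tMin T * N))
        ≤ c * TopicModel.offMass A T →
      -- with the stated probability, the maximum likelihood estimate exists and
      -- each maximizer is supported in the support of the truth
      1 - 2 / (p : ℝ) - 4 / ((max s n : ℕ) : ℝ) - 4 / (K : ℝ) ≤
        P.real {ω | (∃ That, TopicModel.IsMLE A (TopicModel.freq N (Y ω)) That) ∧
          ∀ That, TopicModel.IsMLE A (TopicModel.freq N (Y ω)) That →
            TopicModel.supp That ⊆ TopicModel.supp T} := by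
  -- `C = 10 ^ 6` enters under square roots as a factor `1 / 1000`, and `c = 1 / 1000` leaves room
  -- for the total factor `8 + 90` of the off-support terms.
  refine ⟨10 ^ 6, by norm_num, 1 / 1000, by norm_num, ?_⟩
  rintro p K s n N - hsK - hN A hA T hT rfl Ω _ P _ Y hY hκ hsample hinc
  have hpr := TopicModel.wordLaw_isProbabilityMeasure (TopicModel.mulVec_mem_stdSimplex hA hT)
  have hbound := TopicModel.measureReal_not_recovery_le hA hT hN hsK hκ hsample hinc
  set G : Set (Fin p → ℕ) := {y | (∃ That, TopicModel.IsMLE A (TopicModel.freq N y) That) ∧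
    ∀ That, TopicModel.IsMLE A (TopicModel.freq N y) That →
      TopicModel.supp That ⊆ TopicModel.supp T} with hG
  have hGm : MeasurableSet G := G.to_countable.measurableSet
  have h1 : P.real (Y ⁻¹' G) = (Measure.pi fun _ : Fin N =>
      TopicModel.wordLaw (A.mulVec T)).real (TopicModel.wordCount ⁻¹' G) := by
    rw [measureReal_def, measureReal_def, ← Measure.map_apply_of_aemeasurable hY.aemeasurable hGm,
      hY.map_eq, TopicModel.multinomial, Measure.map_apply (measurable_of_countable _) hGm]
  have h2 : (Measure.pi fun _ : Fin N => TopicModel.wordLaw (A.mulVec T)).real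
      (TopicModel.wordCount ⁻¹' G)ᶜ ≤ _ := hbound
  rw [probReal_compl_eq_one_sub (hGm.preimage (measurable_of_countable _))] at h2
  change _ ≤ P.real (Y ⁻¹' G)
  rw [h1]
  -- The failure bound contains no term in `p`, so `2 / p` is pure slack.
  have h3 : (0 : ℝ) ≤ 2 / p := by positivity
  linarith
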